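/- Let $\Gamma=SL_2(\mathbb{Z})$ and $q=e^{2\pi i\tau}$. Let $E_2,E_4$ be the normalized Eisenstein series of weights $2$ and $4$, $\Delta=q\prod_{n\ge1}(1-q^n)^{24}$, and $j=E_4^3/\Delta$. For integers $w$ and $r\ge -1$ let $QM_w^{(r)}$ be the space of quasimodular forms of weight $w$ and depth $\le r$ on $\Gamma$, i.e. of the functions $\sum_{0\le\ell\le r}E_2^{\ell}f_\ell$ with $f_\ell\in M_{w-2\ell}(\Gamma)$. A form $f\in QM_w^{(1)}\setminus QM_w^{(0)}$ is called normalized extremal (of weight $w$ and depth $1$) if $f=q^{d-1}(1+O(q))$ with $d=\dim_{\mathbb{C}}QM_w^{(1)}$. For every even $w\ge2$ with $w\ne4$ there is exactly one such form; denote it by $G_w^{(1)}$. For even $k\ge2$ define $\mathcal{B}_k^{(1)}$ as follows, where $m\ge0$: $$\mathcal{B}_{12m}^{(1)}=\{E_4^{3m}\}\cup\{E_4^{3(m-\ell)}G_{12\ell}^{(1)}\}_{1\le\ell\le m}\cup\{E_4^{3(m-\ell)-2}G_{12\ell+8}^{(1)}\}_{0\le\ell\le m-1}=\{E_4^{3m},E_4^{3m-2}G_8^{(1)},E_4^{3m-3}G_{12}^{(1)},\dots,G_{12m}^{(1)}\},$$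 $$\mathcal{B}_{12m+2}^{(1)}=\{E_4^{3(m-\ell)}G_{12\ell+2}^{(1)}\}_{0\le\ell\le m}\cup\{E_4^{3(m-\ell)-2}G_{12\ell+10}^{(1)}\}_{0\le\ell\le m-1}=\{E_4^{3m}G_2^{(1)},E_4^{3m-2}G_{10}^{(1)},E_4^{3m-3}G_{14}^{(1)},\dots,G_{12m+2}^{(1)}\},$$ $$\mathcal{B}_{12m+4}^{(1)}=E_4\mathcal{B}_{12m}^{(1)},\quad \mathcal{B}_{12m+6}^{(1)}=E_4\mathcal{B}_{12m+2}^{(1)}\cup\{G_{12m+6}^{(1)}\},$$ $$\mathcal{B}_{12m+8}^{(1)}=E_4^2\mathcal{B}_{12m}^{(1)}\cup\{G_{12m+8}^{(1)}\},\quad \mathcal{B}_{12m+10}^{(1)}=E_4\mathcal{B}_{12m+6}^{(1)}.$$ (The set $\mathcal{B}_0^{(1)}=\{1\}$ serves only to define $\mathcal{B}_4^{(1)}$ and $\mathcal{B}_8^{(1)}$.) Then, for every even $k\ge2$, $\mathcal{B}_k^{(1)}$ is a basis of $QM_k^{(1)}$, and it can be ordered as $f_0,f_1,\dots,f_{d-1}$,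 $d=\dim_{\mathbb{C}} QM_k^{(1)}$, so that $f_n=q^n(1+O(q))$ for $0\le n\le d-1$. Moreover, put $\mathcal{F}_1(t)={}_2F_1(\tfrac1{12},\tfrac5{12};1;1728t)$ and, for $n\ge0$, $$P_n(t)=\mathcal{F}_1(t)\,{}_2F_1(\tfrac{6n+1}{12},\tfrac{6n+5}{12};n+1;1728t),\qquad Q_n(t)=\mathcal{F}_1(t)\,{}_2F_1(\tfrac{6n-1}{12},\tfrac{6n+7}{12};n+1;1728t).$$ Then for every $m\ge0$, as sets of functions of $\tau$ for $\operatorname{Im}\tau$ sufficiently large (germs at $i\infty$), $$\mathcal{B}_{12m}^{(1)}=\mathcal{F}_1(j^{-1})^{12m-2}\left(\{j^{-2\ell}P_{2\ell}(j^{-1})\}_{0\le\ell\le m}\cup\{j^{-2\ell-1}Q_{2\ell+1}(j^{-1})\}_{0\le\ell\le m-1}\right),$$ $$\mathcal{B}_{12m+2}^{(1)}=\mathcal{F}_1(j^{-1})^{12m}\left(\{j^{-2\ell}Q_{2\ell}(j^{-1})\}_{0\le\ell\le m}\cup\{j^{-2\ell-1}P_{2\ell+1}(j^{-1})\}_{0\le\ell\le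 m-1}\right).$$ -/

import Mathlib

open scoped MatrixGroups

noncomputable section

namespace Quasimodular

open UpperHalfPlane

/-- `QM w r`: the quasimodular forms of weight `w` and depth at most `r` on `SL(2, ℤ)`, i.e. the
sums of functions `E₂ ^ l * f` with `0 ≤ l ≤ r` and `f` a modular form of weight `w - 2 * l`.
For `r = -1` this is the zero space, for `r = 0` the space of modular forms of weight `w`. -/
def QM (w r : ℤ) : Submodule ℂ (ℍ → ℂ) :=
  Submodule.span ℂ {F | ∃ l : ℕ, (l : ℤ) ≤ r ∧ ∃ f : ModularForm 𝒮ℒ (w - 2 * (l : ℤ)),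
    F = EisensteinSeries.E2 ^ l * (f : ℍ → ℂ)}

/-- The Fourier expansion of `f` in `q = exp (2 π i τ)` is `q ^ n + O(q ^ (n + 1))`. -/
def HasLeadingTerm (f : ℍ → ℂ) (n : ℕ) : Prop :=
  (qExpansion 1 f).order = (n : ℕ∞) ∧ (qExpansion 1 f).coeff n = 1

/-- `f` is a normalized extremal quasimodular form of weight `w` and depth (exactly) `r`:
its Fourier expansion is `q ^ (m - 1) + O(q ^ m)` with `m = dim QM w r`. -/
def IsNormalizedExtremal (w r : ℤ) (f : ℍ → ℂ) : Prop :=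
  f ∈ QM w r ∧ f ∉ QM w (r - 1) ∧
    ∃ n : ℕ, n + 1 = Module.finrank ℂ (QM w r) ∧ HasLeadingTerm f n

/-- The normalized extremal quasimodular form of weight `w` and depth `1`
(an arbitrary function if there is none). -/
def G (w : ℕ) : ℍ → ℂ := Classical.epsilon (IsNormalizedExtremal (w : ℤ) 1)

/-- The Eisenstein series of weight `4`, as a function. -/
def E4 : ℍ → ℂ := ⇑ModularForm.E₄

/-- The set `E₄ · S`. -/
def E4mul (S : Set (ℍ → ℂ)) : Set (ℍ → ℂ) := (fun f => E4 * f) '' S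

/-- The set `E₄^{3m}, E₄^{3m-2} G₈, E₄^{3m-3} G₁₂, E₄^{3m-5} G₂₀, …, G_{12m}`. -/
def basis0 (m : ℕ) : Set (ℍ → ℂ) :=
  {E4 ^ (3 * m)} ∪
    {f | ∃ l : ℕ, 1 ≤ l ∧ l ≤ m ∧ f = E4 ^ (3 * (m - l)) * G (12 * l)} ∪
    {f | ∃ l : ℕ, l < m ∧ f = E4 ^ (3 * (m - l) - 2) * G (12 * l + 8)}

/-- The set `E₄^{3m} G₂, E₄^{3m-2} G₁₀, E₄^{3m-3} G₁₄, E₄^{3m-5} G₂₂, …, G_{12m+2}`. -/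
def basis2 (m : ℕ) : Set (ℍ → ℂ) :=
  {f | ∃ l : ℕ, l ≤ m ∧ f = E4 ^ (3 * (m - l)) * G (12 * l + 2)} ∪
    {f | ∃ l : ℕ, l < m ∧ f = E4 ^ (3 * (m - l) - 2) * G (12 * l + 10)}

/-- The set attached to the even weight `k` (and the empty set for odd `k`). -/
def extremalBasis (k : ℕ) : Set (ℍ → ℂ) :=
  match k % 12 with
  | 0 => basis0 (k / 12)
  | 2 => basis2 (k / 12)
  | 4 => E4mul (basis0 (k / 12))
  | 6 => E4mul (basis2 (k / 12)) ∪ {G k}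
  | 8 => E4mul (E4mul (basis0 (k / 12))) ∪ {G k}
  | 10 => E4mul (E4mul (basis2 (k / 12)) ∪ {G (12 * (k / 12) + 6)})
  | _ => ∅

/-- The inverse `1 / j = Δ / E₄³` of the elliptic modular function. -/
def jInv (τ : ℍ) : ℂ := ModularForm.discriminant τ / E4 τ ^ 3

/-- `𝓕₁(t) = ₂F₁(1/12, 5/12; 1; 1728 t)`. -/
def F1 (t : ℂ) : ℂ := ₂F₁ (1 / 12 : ℂ) (5 / 12 : ℂ) (1 : ℂ) (1728 * t)

/-- `Pₙ(t)`. -/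
def P (n : ℕ) (t : ℂ) : ℂ :=
  F1 t * ₂F₁ ((6 * (n : ℂ) + 1) / 12) ((6 * (n : ℂ) + 5) / 12) ((n : ℂ) + 1) (1728 * t)

/-- `Qₙ(t)`. -/
def Q (n : ℕ) (t : ℂ) : ℂ :=
  F1 t * ₂F₁ ((6 * (n : ℂ) - 1) / 12) ((6 * (n : ℂ) + 7) / 12) ((n : ℂ) + 1) (1728 * t)

/-- The set `𝓕₁(j⁻¹)^{12m-2} ({j^{-2l} P_{2l}(j⁻¹)}_{0≤l≤m} ∪ {j^{-2l-1} Q_{2l+1}(j⁻¹)}_{0≤l≤m-1})`. -/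
def hypBasis0 (m : ℕ) : Set (ℍ → ℂ) :=
  (fun f τ => F1 (jInv τ) ^ (12 * (m : ℤ) - 2) * f τ) ''
    ({f | ∃ l : ℕ, l ≤ m ∧ f = fun τ => jInv τ ^ (2 * l) * P (2 * l) (jInv τ)} ∪
     {f | ∃ l : ℕ, l < m ∧ f = fun τ => jInv τ ^ (2 * l + 1) * Q (2 * l + 1) (jInv τ)})

/-- The set `𝓕₁(j⁻¹)^{12m} ({j^{-2l} Q_{2l}(j⁻¹)}_{0≤l≤m} ∪ {j^{-2l-1} P_{2l+1}(j⁻¹)}_{0≤l≤m-1})`. -/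
def hypBasis2 (m : ℕ) : Set (ℍ → ℂ) :=
  (fun f τ => F1 (jInv τ) ^ (12 * m) * f τ) ''
    ({f | ∃ l : ℕ, l ≤ m ∧ f = fun τ => jInv τ ^ (2 * l) * Q (2 * l) (jInv τ)} ∪
     {f | ∃ l : ℕ, l < m ∧ f = fun τ => jInv τ ^ (2 * l + 1) * P (2 * l + 1) (jInv τ)})

/-- The germs at `i∞` of the functions in `S`: two functions have the same germ if and only if
they agree on `{τ | A < im τ}` for some `A`. -/
def germs (S : Set (ℍ → ℂ)) : Set (Filter.Germ atImInfty ℂ) :=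
  (fun f : ℍ → ℂ => (f : Filter.Germ atImInfty ℂ)) '' S

end Quasimodular

end

/-! The central fact (`eq_zero_of_X_pow_dvd`) is that a nonzero f = A + E₂B in QM_k^(1) vanishes at
i∞ to order at most k/6 (integer part). With θ = q d/dq, the combination fθ(B) − Bθ(f) + f²/12 is a
genuine modular form of weight 2k, because Ramanujan's formula for θE₂ removes every E₂. If f
vanished to higher order, Sturm's bound would annihilate this form. Yet B vanishes to lower order
than f, so its leading coefficient is nonzero.

Since A and B are determined by f, the dimension is k/6 + 1 (`finrank_QM`). The first k/6 + 1
coefficients are therefore coordinates on QM_k^(1), which yields existence and uniqueness of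
extremal forms. Each set B_k has one element for each leading exponent 0, …, k/6, hence is a basis.

For the hypergeometric formulas, let X_n and Y_n be the extremal forms of weights 6n and 6n+2 (with
X_0 = 1). The Serre derivative with parameter w − 1 maps QM_w^(1) to QM_{w+2}^(1). It keeps the
order of vanishing n, which is the maximal one in weights 6n, 6n+2 and 6n+4, so it sends X_n to a
multiple of Y_n and Y_n to a multiple of E₄X_n. This is a first order linear system
(`theta_extremal0`, `theta_extremal2`) with exponents 0 and n at q = 0, whose solutions are fixed by
their coefficients up to q^n (`eq_zero_of_theta_system`).

Writing X_n = g^(6n−1) j^(−n) u and Y_n = g^(6n+1) j^(−n) v with g = E₄^(1/4) removes E₂ from the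
system (`extremal_eventuallyEq_of_system`). Eliminating one unknown leaves the hypergeometric
equation in 1/j (`exists_system`). The case X_0 = 1 reads g = 𝓕₁(1/j). Products with powers of E₄ =
g⁴ then give the stated sets. -/

noncomputable section

namespace Quasimodular

/-! ### Taylor series at 0 and the Euler operator -/

section
open UpperHalfPlane Filter Topology PowerSeries
open scoped Nat

/-- The Taylor series at `0`. -/
def taylor (f : ℂ → ℂ) : PowerSeries ℂ :=
  PowerSeries.mk fun n => (n ! : ℂ)⁻¹ * iteratedDeriv n f 0

/-- The Euler operator `X d/dX` on power series. -/
def theta (p : PowerSeries ℂ) : PowerSeries ℂ := PowerSeries.mk fun n => n * coeff n p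

@[simp] lemma coeff_theta (n : ℕ) (p : PowerSeries ℂ) : coeff n (theta p) = n * coeff n p :=
  coeff_mk _ _

lemma theta_eq (p : PowerSeries ℂ) : theta p = X * derivative ℂ p := by
  ext n
  rcases n with _ | n
  · simp
  · rw [coeff_theta, coeff_succ_X_mul, coeff_derivative]
    push_cast; ring

lemma theta_mul (p q : PowerSeries ℂ) : theta (p * q) = theta p * q + p * theta q := by
  simp only [theta_eq, Derivation.leibniz, smul_eq_mul]; ring

lemma theta_add (p q : PowerSeries ℂ) : theta (p + q) = theta p + theta q := by
  simp only [theta_eq, map_add]; ring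

lemma theta_X_pow (n : ℕ) : theta (X ^ n) = (n : PowerSeries ℂ) * X ^ n := by
  ext m
  rw [coeff_theta, ← map_natCast (C (R := ℂ)), coeff_C_mul, coeff_X_pow]
  split_ifs with h <;> simp [h]

lemma taylor_congr {f g : ℂ → ℂ} (h : f =ᶠ[𝓝 0] g) : taylor f = taylor g := by
  ext n
  simp [taylor, h.iteratedDeriv_eq n]

lemma coeff_taylor (f : ℂ → ℂ) (n : ℕ) :
    coeff n (taylor f) = (n ! : ℂ)⁻¹ * iteratedDeriv n f 0 := coeff_mk _ _

lemma constantCoeff_taylor (f : ℂ → ℂ) : constantCoeff (taylor f) = f 0 := by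
  rw [← coeff_zero_eq_constantCoeff_apply, coeff_taylor]; simp

lemma taylor_add {f g : ℂ → ℂ} (hf : AnalyticAt ℂ f 0) (hg : AnalyticAt ℂ g 0) :
    taylor (fun z => f z + g z) = taylor f + taylor g := by
  ext n
  have := iteratedDeriv_add (n := n) hf.contDiffAt hg.contDiffAt
  simp only [Pi.add_def] at this
  simp [coeff_taylor, this, mul_add]

lemma taylor_const_mul (c : ℂ) (f : ℂ → ℂ) :
    taylor (fun z => c * f z) = C c * taylor f := by
  ext n
  simp [coeff_taylor, mul_left_comm]

lemma taylor_mul {f g : ℂ → ℂ} (hf : AnalyticAt ℂ f 0) (hg : AnalyticAt ℂ g 0) :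
    taylor (fun z => f z * g z) = taylor f * taylor g := by
  ext n
  have := iteratedDeriv_mul (n := n) hf.contDiffAt hg.contDiffAt
  simp only [Pi.mul_def] at this
  simp only [coeff_taylor, this, Finset.mul_sum, PowerSeries.coeff_mul,
    Finset.Nat.sum_antidiagonal_eq_sum_range_succ_mk, Nat.succ_eq_add_one]
  refine Finset.sum_congr rfl fun i hi ↦ ?_
  rw [Nat.cast_choose _ (by grind)]
  field_simp [Nat.factorial_ne_zero]

lemma taylor_id : taylor (fun z => z) = X := by
  ext n
  rw [coeff_taylor, coeff_X]
  rcases n with _ | _ | n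
  · simp
  · simp
  · rw [iteratedDeriv_succ', iteratedDeriv_succ']
    simp

lemma taylor_deriv (f : ℂ → ℂ) : taylor (deriv f) = derivative ℂ (taylor f) := by
  ext n
  rw [coeff_derivative, coeff_taylor, coeff_taylor, iteratedDeriv_succ', Nat.factorial_succ]
  have : (n : ℂ) + 1 ≠ 0 := by exact_mod_cast n.succ_ne_zero
  push_cast
  field_simp

lemma taylor_theta {f : ℂ → ℂ} (hf : AnalyticAt ℂ f 0) :
    taylor (fun z => z * deriv f z) = theta (taylor f) := by
  rw [taylor_mul (f := fun z => z) analyticAt_id hf.deriv, taylor_id, taylor_deriv, theta_eq]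

lemma taylor_pow {f : ℂ → ℂ} (hf : AnalyticAt ℂ f 0) (n : ℕ) :
    taylor (fun z => f z ^ n) = taylor f ^ n := by
  induction n with
  | zero =>
    ext m
    simp only [pow_zero, coeff_taylor, iteratedDeriv_const, coeff_one]
    split_ifs with h <;> simp [h]
  | succ n ih => simp only [pow_succ]; rw [taylor_mul (f := fun z => f z ^ n) (hf.pow n) hf, ih]

lemma eventually_eq_zero_of_taylor_eq_zero {f : ℂ → ℂ} (hf : AnalyticAt ℂ f 0)
    (h : taylor f = 0) : ∀ᶠ z in 𝓝 0, f z = 0 := by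
  have h1 := hf.hasFPowerSeriesAt
  have h2 : (fun n => iteratedDeriv n f 0 / (n ! : ℂ)) = 0 := by
    funext n
    have := congrArg (coeff n) h
    rw [coeff_taylor, map_zero] at this
    rw [div_eq_inv_mul, this]; rfl
  rw [h2] at h1
  have h3 : FormalMultilinearSeries.ofScalars ℂ (0 : ℕ → ℂ) = 0 := by
    ext n; simp [FormalMultilinearSeries.ofScalars]
  rw [h3] at h1
  exact h1.eventually_eq_zero

lemma eventually_eq_of_taylor_eq {f g : ℂ → ℂ} (hf : AnalyticAt ℂ f 0) (hg : AnalyticAt ℂ g 0)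
    (h : taylor f = taylor g) : f =ᶠ[𝓝 0] g := by
  have h1 := eventually_eq_zero_of_taylor_eq_zero (f := fun z => f z + (-1) * g z)
    (hf.add (analyticAt_const.mul hg)) (by
      rw [taylor_add (g := fun z => (-1) * g z) hf (analyticAt_const.mul hg), taylor_const_mul, h]; simp)
  filter_upwards [h1] with z hz
  linear_combination hz

end

/-! ### Holomorphic functions of q: q-expansions and differentiation -/

section
open UpperHalfPlane Filter Topology PowerSeries Derivative
open scoped Manifold Real

local notation "qq" => Function.Periodic.qParam 1

/-- One-periodic holomorphic functions on the upper half plane that are holomorphic at `i∞`. -/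
structure Regular (f : ℍ → ℂ) : Prop where
  periodic : Function.Periodic (f ∘ ofComplex) (1 : ℝ)
  mdiff : MDiff f
  bdd : IsBoundedAtImInfty f

lemma Regular.analyticAt {f : ℍ → ℂ} (hf : Regular f) : AnalyticAt ℂ (cuspFunction 1 f) 0 :=
  analyticAt_cuspFunction_zero one_pos hf.periodic hf.mdiff hf.bdd

lemma Regular.eq_cuspFunction {f : ℍ → ℂ} (hf : Regular f) (τ : ℍ) :
    f τ = cuspFunction 1 f (qq τ) :=
  (UpperHalfPlane.eq_cuspFunction τ one_ne_zero hf.periodic).symm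

lemma qExpansion_eq_taylor (f : ℍ → ℂ) : qExpansion 1 f = taylor (cuspFunction 1 f) := rfl

lemma Regular.eq_of_qExpansion_eq {f g : ℍ → ℂ} (hf : Regular f) (hg : Regular g)
    (h : qExpansion 1 f = qExpansion 1 g) : f = g := by
  ext τ
  have h1 := hasSum_qExpansion one_pos hf.periodic hf.mdiff hf.bdd τ
  have h2 := hasSum_qExpansion one_pos hg.periodic hg.mdiff hg.bdd τ
  rw [h] at h1
  exact h1.unique h2

lemma exists_qParam_eq {q : ℂ} (hq : ‖q‖ < 1) (h0 : q ≠ 0) : ∃ τ : ℍ, qq τ = q :=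
  ⟨⟨_, Function.Periodic.im_invQParam_pos_of_norm_lt_one one_pos hq h0⟩,
    Function.Periodic.qParam_right_inv one_ne_zero h0⟩

lemma qParam_ofComplex_add_one (z : ℂ) :
    qq (ofComplex (z + (1 : ℝ))) = qq (ofComplex z) := by
  by_cases hz : 0 < z.im
  · have h1 : 0 < (z + (1 : ℝ)).im := by simpa using hz
    rw [ofComplex_apply_of_im_pos hz, ofComplex_apply_of_im_pos h1]
    have := Complex.exp_periodic (2 * π * Complex.I * z)
    simp only [Function.Periodic.qParam, Complex.ofReal_one, div_one]
    rw [← this, mul_add, mul_one]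
  -- Outside the upper half plane `ofComplex` takes a single default value, so periodicity holds
  -- there trivially.
  · have h1 : (z + (1 : ℝ)).im ≤ 0 := by simpa using hz
    rw [ofComplex_apply_of_im_nonpos (not_lt.mp hz), ofComplex_apply_of_im_nonpos h1]

lemma regular_of_eq_comp_qParam {f : ℍ → ℂ} {g : ℂ → ℂ} (hm : MDiff f) (hg : ContinuousAt g 0)
    (h : ∀ τ : ℍ, f τ = g (qq τ)) : Regular f := by
  refine ⟨fun z => ?_, hm, ?_⟩
  · simp only [Function.comp_apply, h, qParam_ofComplex_add_one]
  · have : Tendsto f atImInfty (𝓝 (g 0)) := by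
      have h1 : f = g ∘ fun τ : ℍ => qq τ := funext h
      rw [h1]
      exact Tendsto.comp hg (qParam_tendsto_atImInfty one_pos)
    exact this.isBigO_one ℝ

/-- Every q in the punctured unit disc comes from some τ; continuity of both sides supplies the
value at q = 0. -/
lemma cuspFunction_eventuallyEq {f : ℍ → ℂ} {g : ℂ → ℂ} (hf : Regular f) (hg : ContinuousAt g 0)
    (h : ∀ τ : ℍ, f τ = g (qq τ)) : cuspFunction 1 f =ᶠ[𝓝 0] g := by
  have h1 : ∀ᶠ q in 𝓝[≠] (0 : ℂ), cuspFunction 1 f q = g q := by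
    filter_upwards [self_mem_nhdsWithin, nhdsWithin_le_nhds (Metric.ball_mem_nhds (0 : ℂ) one_pos)]
      with q h0 hq
    obtain ⟨τ, rfl⟩ := exists_qParam_eq (by simpa using hq) h0
    rw [← h, hf.eq_cuspFunction]
  have h2 : cuspFunction 1 f 0 = g 0 :=
    tendsto_nhds_unique
      ((hf.analyticAt.continuousAt.tendsto.mono_left nhdsWithin_le_nhds).congr' h1)
      (hg.tendsto.mono_left nhdsWithin_le_nhds)
  rw [eventually_nhdsWithin_iff] at h1
  filter_upwards [h1] with q hq
  by_cases h0 : q = 0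
  · rw [h0, h2]
  · exact hq h0

lemma Regular.D_eq {f : ℍ → ℂ} (hf : Regular f) (τ : ℍ) :
    D f τ = qq τ * deriv (cuspFunction 1 f) (qq τ) := by
  have h1 : (f ∘ ofComplex) =ᶠ[𝓝 (τ : ℂ)] fun z => cuspFunction 1 f (qq z) := by
    filter_upwards [isOpen_upperHalfPlaneSet.mem_nhds τ.im_pos] with z hz
    rw [Function.comp_apply, hf.eq_cuspFunction, ofComplex_apply_of_im_pos hz]
  have h2 : HasDerivAt (fun z : ℂ => qq z) (2 * π * Complex.I * qq τ) (τ : ℂ) := by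
    have : HasDerivAt (fun z : ℂ => Complex.exp (2 * π * Complex.I * z / (1 : ℝ)))
        (Complex.exp (2 * π * Complex.I * τ / (1 : ℝ)) * (2 * π * Complex.I * 1 / (1 : ℝ)))
        (τ : ℂ) :=
      HasDerivAt.cexp (((hasDerivAt_id _).const_mul _).div_const _)
    convert! this using 1
    simp only [Function.Periodic.qParam]
    push_cast; ring
  have h3 : DifferentiableAt ℂ (cuspFunction 1 f) (qq τ) :=
    differentiableAt_cuspFunction one_pos hf.periodic hf.mdiff hf.bdd
      (Function.Periodic.norm_qParam_lt_one one_pos τ.im_pos)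
  have h4 := h3.hasDerivAt.comp (τ : ℂ) h2
  rw [normalizedDerivOfComplex, h1.deriv_eq]
  rw [show (fun z => cuspFunction 1 f (qq z)) = cuspFunction 1 f ∘ fun z => qq z from rfl, h4.deriv]
  have : (2 * π * Complex.I : ℂ) ≠ 0 := Complex.two_pi_I_ne_zero
  field_simp

lemma Regular.D {f : ℍ → ℂ} (hf : Regular f) : Regular (D f) :=
  regular_of_eq_comp_qParam (normalizedDerivOfComplex_mdifferentiable hf.mdiff)
    (g := fun q => q * deriv (cuspFunction 1 f) q)
    (analyticAt_id.mul hf.analyticAt.deriv).continuousAt hf.D_eq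

lemma Regular.cuspFunction_D {f : ℍ → ℂ} (hf : Regular f) :
    cuspFunction 1 (Derivative.normalizedDerivOfComplex f) =ᶠ[𝓝 0]
      fun q => q * deriv (cuspFunction 1 f) q :=
  cuspFunction_eventuallyEq hf.D (analyticAt_id.mul hf.analyticAt.deriv).continuousAt hf.D_eq

lemma Regular.qExpansion_D {f : ℍ → ℂ} (hf : Regular f) :
    qExpansion 1 (Derivative.normalizedDerivOfComplex f) = theta (qExpansion 1 f) := by
  rw [qExpansion_eq_taylor, taylor_congr hf.cuspFunction_D, taylor_theta hf.analyticAt]; rfl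

lemma Regular.add {f g : ℍ → ℂ} (hf : Regular f) (hg : Regular g) : Regular (f + g) :=
  ⟨fun z => congrArg₂ (· + ·) (hf.periodic z) (hg.periodic z), hf.mdiff.add hg.mdiff,
    hf.bdd.add hg.bdd⟩

lemma Regular.mul {f g : ℍ → ℂ} (hf : Regular f) (hg : Regular g) : Regular (f * g) :=
  ⟨fun z => congrArg₂ (· * ·) (hf.periodic z) (hg.periodic z), hf.mdiff.mul hg.mdiff,
    hf.bdd.mul hg.bdd⟩

lemma Regular.smul {f : ℍ → ℂ} (c : ℂ) (hf : Regular f) : Regular (c • f) :=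
  ⟨fun z => congrArg (c • ·) (hf.periodic z), hf.mdiff.const_smul c, hf.bdd.const_smul_left c⟩

lemma Regular.qExpansion_add {f g : ℍ → ℂ} (hf : Regular f) (hg : Regular g) :
    qExpansion 1 (f + g) = qExpansion 1 f + qExpansion 1 g :=
  UpperHalfPlane.qExpansion_add hf.analyticAt hg.analyticAt

lemma Regular.qExpansion_mul {f g : ℍ → ℂ} (hf : Regular f) (hg : Regular g) :
    qExpansion 1 (f * g) = qExpansion 1 f * qExpansion 1 g :=
  UpperHalfPlane.qExpansion_mul hf.analyticAt hg.analyticAt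

lemma Regular.qExpansion_smul {f : ℍ → ℂ} (c : ℂ) (hf : Regular f) :
    qExpansion 1 (c • f) = C c * qExpansion 1 f := by
  rw [UpperHalfPlane.qExpansion_smul hf.analyticAt c, PowerSeries.smul_eq_C_mul]

lemma regular_modularForm {k : ℤ} (f : ModularForm 𝒮ℒ k) : Regular f :=
  ⟨by
    simpa using SlashInvariantFormClass.periodic_comp_ofComplex f
      (h := 1) one_mem_strictPeriods_SL,
    f.holo', ModularFormClass.bdd_at_infty f⟩

lemma regular_E2 : Regular EisensteinSeries.E2 := by
  refine ⟨fun z => ?_, E2_mdifferentiable, EisensteinSeries.isBoundedAtImInfty_E2⟩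
  have h := qParam_ofComplex_add_one z
  simp only [Function.Periodic.qParam, Complex.ofReal_one, div_one] at h
  simp only [Function.comp_apply, EisensteinSeries.E2_eq_tsum_cexp, Complex.ofReal_one, h]

lemma hasSum_qExpansion_E2 (τ : ℍ) :
    HasSum (fun m : ℕ => (if m = 0 then 1 else -24 * ArithmeticFunction.sigma 1 m : ℂ) • qq τ ^ m)
      (EisensteinSeries.E2 τ) := by
  simpa only [Function.Periodic.qParam, Complex.ofReal_one, div_one]
    using EisensteinSeries.hasSum_qExpansion_E2 (z := τ)

lemma constantCoeff_qExpansion_E2 : constantCoeff (qExpansion 1 EisensteinSeries.E2) = 1 := by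
  have h := hasFPowerSeriesOnBall_cuspFunction one_pos regular_E2.analyticAt hasSum_qExpansion_E2
  rw [qExpansion_eq_taylor, constantCoeff_taylor, ← h.coeff_zero 0]
  simp

end

/-! ### Serre derivatives and Ramanujan's identities -/

section
open UpperHalfPlane Filter Topology PowerSeries Derivative ModularForm
open scoped Manifold Real

/-- A modular form of level one from a regular function. -/
def Regular.toModularForm {k : ℤ} {f : ℍ → ℂ} (hf : Regular f)
    (h : ∀ γ : SL(2, ℤ), f ∣[k] γ = f) : ModularForm 𝒮ℒ k where
  toFun := f
  slash_action_eq' := fun _ ⟨γ, hγ⟩ ↦ hγ ▸ h γ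
  holo' := hf.mdiff
  bdd_at_cusps' {c} hc := by
    -- All cusps are equivalent to ∞ under SL₂(ℤ), and f is invariant, so boundedness at i∞
    -- suffices.
    rw [Subgroup.IsArithmetic.isCusp_iff_isCusp_SL2Z] at hc
    rw [OnePoint.isBoundedAt_iff_forall_SL2Z hc]
    intro γ _
    rw [h γ]
    exact hf.bdd

lemma serreDerivative_eq_add (k : ℂ) (f : ℍ → ℂ) :
    serreDerivative k f = D f + (-(k / 12)) • (EisensteinSeries.E2 * f) := by
  ext τ
  simp [serreDerivative]; ring

lemma Regular.serreDerivative {f : ℍ → ℂ} (hf : Regular f) (k : ℂ) :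
    Regular (serreDerivative k f) := by
  rw [serreDerivative_eq_add]
  exact hf.D.add ((regular_E2.mul hf).smul _)

lemma Regular.qExpansion_serreDerivative {f : ℍ → ℂ} (hf : Regular f) (k : ℂ) :
    qExpansion 1 (Derivative.serreDerivative k f) = theta (qExpansion 1 f) -
      C (k / 12) * (qExpansion 1 EisensteinSeries.E2 * qExpansion 1 f) := by
  rw [serreDerivative_eq_add, hf.D.qExpansion_add ((regular_E2.mul hf).smul _), hf.qExpansion_D,
    (regular_E2.mul hf).qExpansion_smul, regular_E2.qExpansion_mul hf]
  simp; ring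

lemma slash_modularForm {k : ℤ} (f : ModularForm 𝒮ℒ k) (γ : SL(2, ℤ)) :
    (f : ℍ → ℂ) ∣[k] γ = f :=
  SlashInvariantForm.slash_action_eqn f _ ⟨γ, rfl⟩

/-- The Serre derivative of a modular form of level one. -/
def serreForm {k : ℤ} (f : ModularForm 𝒮ℒ k) : ModularForm 𝒮ℒ (k + 2) :=
  ((regular_modularForm f).serreDerivative k).toModularForm fun γ =>
    serreDerivative_slash_invariant f.holo' (slash_modularForm f γ)

lemma coe_serreForm {k : ℤ} (f : ModularForm 𝒮ℒ k) :
    (serreForm f : ℍ → ℂ) = serreDerivative k f := rfl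

lemma qExpansion_serreForm {k : ℤ} (f : ModularForm 𝒮ℒ k) :
    qExpansion 1 (serreForm f) = theta (qExpansion 1 f) -
      C (k / 12 : ℂ) * (qExpansion 1 EisensteinSeries.E2 * qExpansion 1 f) := by
  rw [coe_serreForm, (regular_modularForm f).qExpansion_serreDerivative]

lemma hasDerivAt_div_denom (γ : SL(2, ℤ)) (τ : ℍ) :
    HasDerivAt ((fun z : ℍ => (γ 1 0 : ℂ) / denom γ z) ∘ ofComplex)
      (-((γ 1 0 : ℂ) / denom γ τ) ^ 2) (τ : ℂ) := by
  have h := (hasDerivAt_denom_zpow (γ : GL (Fin 2) ℝ) (-1) τ).const_mul (γ 1 0 : ℂ)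
  refine (h.congr_deriv ?_).congr_of_eventuallyEq ?_
  · have := denom_ne_zero γ τ
    simp
    ring
  · filter_upwards [isOpen_upperHalfPlaneSet.mem_nhds τ.im_pos] with w hw
    simp [ofComplex_apply_of_im_pos hw, div_eq_mul_inv]

lemma E2_slash (γ : SL(2, ℤ)) : EisensteinSeries.E2 ∣[(2 : ℤ)] γ =
    EisensteinSeries.E2 - (6 * Complex.I / π : ℂ) • fun z : ℍ => (γ 1 0 : ℂ) / denom γ z := by
  rw [EisensteinSeries.E2_slash_action]
  ext z
  have : (π : ℂ) ≠ 0 := by exact_mod_cast Real.pi_ne_zero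
  simp [EisensteinSeries.D2, riemannZeta_two]
  field_simp

/-- The parameter is 1, not the weight 2: with this choice the anomaly of E₂² cancels that of the
derivative of E₂. The derivative of κ = c/(cz+d) being −κ² makes the quadratic terms match. -/
lemma serreDerivative_E2_slash (γ : SL(2, ℤ)) :
    serreDerivative 1 EisensteinSeries.E2 ∣[(4 : ℤ)] γ =
      serreDerivative 1 EisensteinSeries.E2 := by
  set κ : ℍ → ℂ := fun z : ℍ => (γ 1 0 : ℂ) / denom γ z with hκ
  have hm : MDiff κ := fun τ =>
    UpperHalfPlane.mdifferentiableAt_iff.mpr (hasDerivAt_div_denom γ τ).differentiableAt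
  have hD : D κ = fun τ => (2 * π * Complex.I)⁻¹ * (-(κ τ) ^ 2) := by
    ext τ
    rw [normalizedDerivOfComplex, (hasDerivAt_div_denom γ τ).deriv]
  have h1 := normalizedDerivOfComplex_SL_slash (k := 2) E2_mdifferentiable (γ := γ)
  rw [E2_slash, normalizedDerivOfComplex_sub _ _ E2_mdifferentiable (hm.const_smul _),
    normalizedDerivOfComplex_smul _ _ hm, hD] at h1
  ext τ
  have h2 := congrFun h1 τ
  have h3 : (serreDerivative 1 EisensteinSeries.E2 ∣[(4 : ℤ)] γ) τ =
      (D EisensteinSeries.E2 ∣[(4 : ℤ)] γ) τ -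
        12⁻¹ * ((EisensteinSeries.E2 ∣[(2 : ℤ)] γ) τ * (EisensteinSeries.E2 ∣[(2 : ℤ)] γ) τ) := by
    have := congrFun (ModularForm.mul_slash_SL2 2 2 γ EisensteinSeries.E2 EisensteinSeries.E2) τ
    rw [show (2 + 2 : ℤ) = 4 by norm_num, Pi.mul_apply] at this
    rw [← this]
    simp only [ModularForm.SL_slash_apply, serreDerivative_apply, Pi.mul_apply]
    ring
  rw [h3, E2_slash]
  simp only [Pi.sub_apply, Pi.smul_apply, smul_eq_mul, serreDerivative_apply] at h2 ⊢
  have hpi : (π : ℂ) ≠ 0 := by exact_mod_cast Real.pi_ne_zero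
  rw [show (2 + 2 : ℤ) = 4 by norm_num] at h2
  have hI : (Complex.I)⁻¹ = -Complex.I := Complex.inv_I
  simp only [mul_inv, hI] at h2
  rw [eq_sub_iff_add_eq] at h2
  rw [← h2]
  change _ + _ - 12⁻¹ * ((_ - _ * κ τ) * (_ - _ * κ τ)) = _
  rw [show ((γ 1 0 : ℤ) : ℂ) / denom γ τ = κ τ from rfl]
  push_cast
  field_simp
  ring_nf

lemma constantCoeff_qExpansion_E4 : constantCoeff (qExpansion 1 E₄) = 1 := by
  rw [← coeff_zero_eq_constantCoeff_apply, EisensteinSeries.E_qExpansion_coeff_zero _ ⟨2, rfl⟩]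

lemma constantCoeff_qExpansion_E6 : constantCoeff (qExpansion 1 E₆) = 1 := by
  rw [← coeff_zero_eq_constantCoeff_apply, EisensteinSeries.E_qExpansion_coeff_zero _ ⟨3, rfl⟩]

/-- Below weight 12 Sturm's bound is 0, so the constant term decides. Each of Ramanujan's three
identities then needs only one constant term. -/
lemma eq_smul_of_constantCoeff {k : ℤ} (hk : k < 12) (f g : ModularForm 𝒮ℒ k)
    (hg : constantCoeff (qExpansion 1 g) = 1) :
    f = constantCoeff (qExpansion 1 f) • g := by
  rw [← sub_eq_zero]
  apply sturm_bound_levelOne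
  rw [show k.toNat / 12 = 0 by omega]
  have : qExpansion 1 ⇑(f - (constantCoeff (qExpansion 1 f)) • g) =
      qExpansion 1 f - constantCoeff (qExpansion 1 f) • qExpansion 1 g := by
    rw [FunLike.coe_sub, ModularForm.qExpansion_sub one_pos one_mem_strictPeriods_SL,
      FunLike.coe_smul, ModularForm.qExpansion_smul one_pos one_mem_strictPeriods_SL]
  rw [this]
  refine lt_of_lt_of_le (b := (1 : ℕ∞)) (by norm_num) (PowerSeries.le_order _ _ fun i hi => ?_)
  obtain rfl : i = 0 := by
    have : i < 1 := by exact_mod_cast hi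
    omega
  simp [hg]

lemma constantCoeff_theta (p : PowerSeries ℂ) : constantCoeff (theta p) = 0 := by
  rw [← coeff_zero_eq_constantCoeff_apply]; simp

lemma D_E2 : D EisensteinSeries.E2 =
    (12⁻¹ : ℂ) • (EisensteinSeries.E2 * EisensteinSeries.E2 + (-1 : ℂ) • E4) := by
  have h := eq_smul_of_constantCoeff (by norm_num)
    ((regular_E2.serreDerivative 1).toModularForm serreDerivative_E2_slash) E₄
    constantCoeff_qExpansion_E4
  have h2 : constantCoeff (qExpansion 1 ((regular_E2.serreDerivative 1).toModularForm
      serreDerivative_E2_slash)) = -1 / 12 := by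
    change constantCoeff (qExpansion 1 (serreDerivative 1 EisensteinSeries.E2)) = _
    rw [regular_E2.qExpansion_serreDerivative]
    simp [constantCoeff_theta, constantCoeff_qExpansion_E2]; norm_num
  rw [h2] at h
  ext τ
  have h3 := congrArg (fun f : ModularForm 𝒮ℒ 4 => f τ) h
  have h4 : serreDerivative 1 EisensteinSeries.E2 τ = (-1 / 12 : ℂ) * E4 τ := h3
  simp only [serreDerivative_apply] at h4
  simp only [Pi.smul_apply, Pi.add_apply, Pi.mul_apply, smul_eq_mul]
  linear_combination h4

lemma D_modularForm {k : ℤ} (f : ModularForm 𝒮ℒ k) (τ : ℍ) :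
    D f τ = serreForm f τ + k / 12 * EisensteinSeries.E2 τ * f τ := by
  change _ = serreDerivative k f τ + _
  simp only [serreDerivative_apply]; ring

lemma constantCoeff_serreForm {k : ℤ} (f : ModularForm 𝒮ℒ k) :
    constantCoeff (qExpansion 1 (serreForm f)) = -(k / 12) * constantCoeff (qExpansion 1 f) := by
  rw [qExpansion_serreForm]
  simp [constantCoeff_theta, constantCoeff_qExpansion_E2]

lemma D_E4 (τ : ℍ) : D E4 τ = (EisensteinSeries.E2 τ * E4 τ - E₆ τ) / 3 := by
  have h := eq_smul_of_constantCoeff (by norm_num) (serreForm E₄) E₆ constantCoeff_qExpansion_E6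
  rw [constantCoeff_serreForm, constantCoeff_qExpansion_E4] at h
  have h1 := D_modularForm E₄ τ
  have h3 : serreForm E₄ τ = (-((4 : ℤ) / 12 : ℂ) * 1) * E₆ τ :=
    congrArg (fun f : ModularForm 𝒮ℒ 6 => f τ) h
  rw [h3] at h1
  change D E4 τ = _ + _ * E4 τ at h1
  rw [h1]; push_cast; ring

lemma D_E6 (τ : ℍ) : D E₆ τ = (EisensteinSeries.E2 τ * E₆ τ - E4 τ ^ 2) / 2 := by
  have h := eq_smul_of_constantCoeff (by norm_num) (serreForm E₆) (E₄.mul E₄) (by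
    rw [ModularForm.qExpansion_mul one_pos one_mem_strictPeriods_SL]
    simp [constantCoeff_qExpansion_E4])
  rw [constantCoeff_serreForm, constantCoeff_qExpansion_E6] at h
  have h1 := D_modularForm E₆ τ
  have h3 : serreForm E₆ τ = (-((6 : ℤ) / 12 : ℂ) * 1) * (E4 τ * E4 τ) :=
    congrArg (fun f : ModularForm 𝒮ℒ 8 => f τ) h
  rw [h3] at h1
  rw [h1]; push_cast; ring

end

/-! ### Depth one quasimodular forms and the bound on their order of vanishing -/

section
open UpperHalfPlane Filter Topology PowerSeries Derivative ModularForm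
open scoped Manifold Real

local notation "E₂" => EisensteinSeries.E2

lemma mem_QM_zero {w : ℤ} {f : ℍ → ℂ} :
    f ∈ QM w 0 ↔ ∃ A : ModularForm 𝒮ℒ w, f = A := by
  constructor
  · intro hf
    induction hf using Submodule.span_induction with
    | mem x hx =>
      obtain ⟨l, hl, g, rfl⟩ := hx
      obtain rfl : l = 0 := by omega
      exact ⟨ModularForm.mcast (by simp) g, by ext; simp⟩
    | zero => exact ⟨0, rfl⟩
    | add x y _ _ hx hy =>
      obtain ⟨A, rfl⟩ := hx
      obtain ⟨A', rfl⟩ := hy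
      exact ⟨A + A', rfl⟩
    | smul c x _ hx =>
      obtain ⟨A, rfl⟩ := hx
      exact ⟨c • A, rfl⟩
  · rintro ⟨A, rfl⟩
    exact Submodule.subset_span ⟨0, by simp, ModularForm.mcast (by simp) A, by ext; simp⟩

lemma mem_QM_one {w : ℤ} {f : ℍ → ℂ} :
    f ∈ QM w 1 ↔ ∃ (A : ModularForm 𝒮ℒ w) (B : ModularForm 𝒮ℒ (w - 2)), f = A + E₂ * B := by
  constructor
  · intro hf
    induction hf using Submodule.span_induction with
    | mem x hx =>
      obtain ⟨l, hl, g, rfl⟩ := hx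
      obtain rfl | rfl : l = 0 ∨ l = 1 := by omega
      · exact ⟨ModularForm.mcast (by simp) g, 0, by ext; simp⟩
      · exact ⟨0, ModularForm.mcast (by simp) g, by ext; simp⟩
    | zero => exact ⟨0, 0, by ext; simp⟩
    | add x y _ _ hx hy =>
      obtain ⟨A, B, rfl⟩ := hx
      obtain ⟨A', B', rfl⟩ := hy
      exact ⟨A + A', B + B', by ext; simp; ring⟩
    | smul c x _ hx =>
      obtain ⟨A, B, rfl⟩ := hx
      exact ⟨c • A, c • B, by ext; simp; ring⟩
  · rintro ⟨A, B, rfl⟩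
    refine Submodule.add_mem _
      (Submodule.subset_span ⟨0, by simp, ModularForm.mcast (by simp) A, by ext; simp⟩)
      (Submodule.subset_span ⟨1, by simp, ModularForm.mcast (by simp) B, by ext; simp⟩)

lemma regular_of_mem_QM {w : ℤ} {f : ℍ → ℂ} (hf : f ∈ QM w 1) : Regular f := by
  obtain ⟨A, B, rfl⟩ := mem_QM_one.mp hf
  exact (regular_modularForm A).add (regular_E2.mul (regular_modularForm B))

lemma qExpansion_add_E2_mul {v w : ℤ} (A : ModularForm 𝒮ℒ w) (B : ModularForm 𝒮ℒ v) :
    qExpansion 1 (A + E₂ * B : ℍ → ℂ) = qExpansion 1 A + qExpansion 1 E₂ * qExpansion 1 B := by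
  rw [(regular_modularForm A).qExpansion_add (regular_E2.mul (regular_modularForm B)),
    regular_E2.qExpansion_mul (regular_modularForm B)]

lemma regular_E4 : Regular E4 := regular_modularForm E₄

lemma theta_E2 : theta (qExpansion 1 E₂) =
    C (12⁻¹ : ℂ) * (qExpansion 1 E₂ ^ 2 - qExpansion 1 E4) := by
  rw [← regular_E2.qExpansion_D, D_E2,
    ((regular_E2.mul regular_E2).add (regular_E4.smul _)).qExpansion_smul,
    (regular_E2.mul regular_E2).qExpansion_add (regular_E4.smul _),
    regular_E2.qExpansion_mul regular_E2, regular_E4.qExpansion_smul]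
  simp; ring

/-- The Wronskian-like modular form of weight `2 w` attached to the quasimodular form
`A + E₂ B`. -/
def wronskianForm {w : ℤ} (A : ModularForm 𝒮ℒ w) (B : ModularForm 𝒮ℒ (w - 2)) :
    ModularForm 𝒮ℒ (2 * w) :=
  ModularForm.mcast (by ring) (A.mul (serreForm B)) -
    ModularForm.mcast (by ring) (B.mul (serreForm A)) +
    (12⁻¹ : ℂ) • (ModularForm.mcast (by ring) (A.mul A) +
      ModularForm.mcast (by ring) ((E₄.mul B).mul B))

/-- The right side shows the order of vanishing, the left side the modularity. The term f²/12
absorbs what θE₂ = (E₂² − E₄)/12 and the difference 2 between the weights of A and B leave over. -/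
lemma qExpansion_wronskianForm {w : ℤ} (A : ModularForm 𝒮ℒ w) (B : ModularForm 𝒮ℒ (w - 2)) :
    let f := qExpansion 1 (A + E₂ * B : ℍ → ℂ)
    let b := qExpansion 1 B
    qExpansion 1 (wronskianForm A B) = f * theta b - b * theta f + C (12⁻¹ : ℂ) * f ^ 2 := by
  intro f b
  have hA := regular_modularForm A
  have hB := regular_modularForm B
  have hSA := regular_modularForm (serreForm A)
  have hSB := regular_modularForm (serreForm B)
  have h0 : (wronskianForm A B : ℍ → ℂ) = (A * serreForm B + (-1 : ℂ) • (B * serreForm A) : ℍ → ℂ) +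
      (12⁻¹ : ℂ) • (A * A + E4 * B * B : ℍ → ℂ) := by
    ext τ
    simp [wronskianForm, E4]
    ring
  have hk : (C ((w - 2 : ℤ) / 12 : ℂ) : PowerSeries ℂ) = C (w / 12 : ℂ) - 2 * C (12⁻¹ : ℂ) := by
    rw [← map_ofNat (C (R := ℂ)) 2, ← map_mul, ← map_sub]
    congr 1; push_cast; ring
  rw [h0, ((hA.mul hSB).add ((hB.mul hSA).smul _)).qExpansion_add
      (((hA.mul hA).add ((regular_E4.mul hB).mul hB)).smul _),
    (hA.mul hSB).qExpansion_add ((hB.mul hSA).smul _), hA.qExpansion_mul hSB,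
    (hB.mul hSA).qExpansion_smul, hB.qExpansion_mul hSA,
    ((hA.mul hA).add ((regular_E4.mul hB).mul hB)).qExpansion_smul,
    (hA.mul hA).qExpansion_add ((regular_E4.mul hB).mul hB), hA.qExpansion_mul hA,
    (regular_E4.mul hB).qExpansion_mul hB, regular_E4.qExpansion_mul hB,
    qExpansion_serreForm, qExpansion_serreForm, hk]
  simp only [f, b, qExpansion_add_E2_mul, theta_add, theta_mul, theta_E2]
  simp only [map_neg, map_one]
  ring

lemma exists_eq_X_pow_mul {p : PowerSeries ℂ} (hp : p ≠ 0) :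
    ∃ (n : ℕ) (u : PowerSeries ℂ), p = X ^ n * u ∧ constantCoeff u ≠ 0 ∧ p.order = n := by
  have hfin := order_finite_iff_ne_zero.mpr hp
  obtain ⟨u, hu⟩ := X_pow_order_dvd (φ := p)
  refine ⟨p.order.toNat, u, hu, fun h => ?_, ?_⟩
  · have h1 := coeff_order hp
    have h2 : coeff p.order.toNat p = coeff p.order.toNat (X ^ p.order.toNat * u) :=
      congrArg _ hu
    rw [h2, coeff_X_pow_mul', if_pos le_rfl, Nat.sub_self, coeff_zero_eq_constantCoeff_apply] at h1
    exact h1 h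
  · exact (ENat.natCast_toNat (lt_top_iff_ne_top.mp hfin)).symm

/-- The coefficients up to `q ^ (k / 6)` determine a quasimodular form of weight `k`
and depth at most one. -/
theorem eq_zero_of_X_pow_dvd {k : ℕ} {f : ℍ → ℂ} (hf : f ∈ QM k 1)
    (h : X ^ (k / 6 + 1) ∣ qExpansion 1 f) : f = 0 := by
  have hreg := regular_of_mem_QM hf
  obtain ⟨A, B, hAB⟩ := mem_QM_one.mp hf
  by_contra hne
  have hp : qExpansion 1 f ≠ 0 := fun h0 => hne <| by
    refine hreg.eq_of_qExpansion_eq (regular_modularForm (0 : ModularForm 𝒮ℒ 0)) ?_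
    rw [h0]; exact (qExpansion_zero 1).symm
  obtain ⟨n, u, hu, hu0, hn⟩ := exists_eq_X_pow_mul hp
  have hkn : k / 6 + 1 ≤ n := by
    by_contra hlt
    have := X_pow_dvd_iff.mp h n (by omega)
    rw [hu, coeff_X_pow_mul', if_pos le_rfl, Nat.sub_self,
      coeff_zero_eq_constantCoeff_apply] at this
    exact hu0 this
  by_cases hB : B = 0
  · have hfA : f = A := by rw [hAB, hB]; ext; simp
    have : A = 0 := by
      apply sturm_bound_levelOne
      rw [← hfA, hn]
      have : ((k : ℤ).toNat) / 12 < n := by rw [Int.toNat_natCast]; omega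
      exact_mod_cast this
    exact hne (by rw [hfA, this]; rfl)
  have hpB : qExpansion 1 B ≠ 0 := fun h0 => hB <|
    (ModularForm.qExpansion_eq_zero_iff one_pos one_mem_strictPeriods_SL B).mp h0
  obtain ⟨b, v, hv, hv0, hb⟩ := exists_eq_X_pow_mul hpB
  -- Sturm's bound in weight k − 2 limits the order b of B to about k/12, below n.
  have hbn : b < n := by
    by_contra hlt
    refine hB (sturm_bound_levelOne ?_)
    rw [hb]
    have : ((k : ℤ) - 2).toNat / 12 < b := by omega
    exact_mod_cast this
  have hW := qExpansion_wronskianForm A B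
  simp only [← hAB] at hW
  -- With f = qⁿu and B = q^b v, all terms are divisible by q^(n+b); f² carries an extra q^(n−b), so
  -- it does not affect the leading coefficient.
  have hW1 : qExpansion 1 (wronskianForm A B) = X ^ (n + b) *
      (u * ((b : PowerSeries ℂ) * v + theta v) - v * ((n : PowerSeries ℂ) * u + theta u) +
        C (12⁻¹ : ℂ) * X ^ (n - b) * u ^ 2) := by
    obtain ⟨c, rfl⟩ := Nat.exists_eq_add_of_lt hbn
    rw [hW, hu, hv]
    simp only [theta_mul, theta_X_pow]
    rw [show b + c + 1 - b = c + 1 by omega]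
    ring
  -- Sturm's bound in weight 2k is exactly k/6, which is less than n.
  have hW0 : wronskianForm A B = 0 := by
    apply sturm_bound_levelOne
    have : (((2 * (k : ℤ)).toNat / 12 : ℕ) : ℕ∞) < (n : ℕ∞) := by
      have : ((2 * (k : ℤ)).toNat / 12) < n := by omega
      exact_mod_cast this
    refine this.trans_le (PowerSeries.le_order _ _ fun i hi => ?_)
    have hi' : i < n := by exact_mod_cast hi
    rw [hW1, coeff_X_pow_mul', if_neg (by omega)]
  rw [hW0, FunLike.coe_zero, qExpansion_zero] at hW1
  have h2 := congrArg (coeff (n + b)) hW1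
  rw [coeff_X_pow_mul', if_pos le_rfl, Nat.sub_self, coeff_zero_eq_constantCoeff_apply] at h2
  simp only [map_zero, map_add, map_sub, map_mul, map_pow, constantCoeff_theta, constantCoeff_X,
    zero_pow (Nat.sub_ne_zero_of_lt hbn), map_natCast] at h2
  -- The leading coefficient of the vanishing form is (b − n)u(0)v(0), although none of these
  -- factors is zero.
  have h3 : ((n : ℂ) - b) * (constantCoeff u * constantCoeff v) = 0 := by linear_combination h2
  have h4 : (n : ℂ) - b ≠ 0 := sub_ne_zero.mpr (by exact_mod_cast hbn.ne')
  exact mul_ne_zero h4 (mul_ne_zero hu0 hv0) h3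

lemma eq_of_coeff_eq {k : ℕ} {f g : ℍ → ℂ} (hf : f ∈ QM k 1) (hg : g ∈ QM k 1)
    (h : ∀ i ≤ k / 6, coeff i (qExpansion 1 f) = coeff i (qExpansion 1 g)) : f = g := by
  rw [← sub_eq_zero]
  refine eq_zero_of_X_pow_dvd (Submodule.sub_mem _ hf hg) (X_pow_dvd_iff.mpr fun m hm => ?_)
  rw [UpperHalfPlane.qExpansion_sub (regular_of_mem_QM hf).analyticAt
    (regular_of_mem_QM hg).analyticAt, map_sub, h m (by omega), sub_self]

lemma HasLeadingTerm.coeff_eq {f : ℍ → ℂ} {n : ℕ} (h : HasLeadingTerm f n) {i : ℕ} (hi : i ≤ n) :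
    coeff i (qExpansion 1 f) = if i = n then 1 else 0 := by
  split_ifs with hin
  · rw [hin]; exact h.2
  · apply coeff_of_lt_order
    rw [h.1]
    exact_mod_cast lt_of_le_of_ne hi hin

lemma hasLeadingTerm_of_coeff {f : ℍ → ℂ} {n : ℕ}
    (h : ∀ i ≤ n, coeff i (qExpansion 1 f) = if i = n then 1 else 0) : HasLeadingTerm f n := by
  have h1 := h n le_rfl
  rw [if_pos rfl] at h1
  refine ⟨order_eq_nat.mpr ⟨by rw [h1]; exact one_ne_zero, fun i hi => ?_⟩, h1⟩
  rw [h i hi.le, if_neg hi.ne]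

lemma HasLeadingTerm.unique {k : ℕ} {f g : ℍ → ℂ} (hf : f ∈ QM k 1) (hg : g ∈ QM k 1)
    (hf' : HasLeadingTerm f (k / 6)) (hg' : HasLeadingTerm g (k / 6)) : f = g :=
  eq_of_coeff_eq hf hg fun i hi => by rw [hf'.coeff_eq hi, hg'.coeff_eq hi]

end

/-! ### Dimension, existence and uniqueness of extremal forms -/

section
open UpperHalfPlane Filter Topology PowerSeries Derivative ModularForm
open scoped Manifold Real

local notation "E₂" => EisensteinSeries.E2

/-- If E₂B = −A were modular, comparing it with its transform under S would isolate the anomaly of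
E₂, a nowhere vanishing function times B. -/
lemma eq_zero_of_add_E2_mul_eq_zero {w : ℤ} {A : ModularForm 𝒮ℒ w}
    {B : ModularForm 𝒮ℒ (w - 2)} (h : (A + E₂ * B : ℍ → ℂ) = 0) : A = 0 ∧ B = 0 := by
  have hB : B = 0 := by
    ext τ
    have h1 := ModularForm.mul_slash_SL2 2 (w - 2) ModularGroup.S E₂ B
    rw [show 2 + (w - 2) = w by ring, slash_modularForm, E2_slash] at h1
    have h2 : (E₂ * B : ℍ → ℂ) = -A := by rw [eq_neg_iff_add_eq_zero, add_comm]; exact h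
    rw [h2, SlashAction.neg_slash, slash_modularForm, ← h2] at h1
    have h3 := congrFun h1 τ
    simp only [Pi.mul_apply, Pi.sub_apply, Pi.smul_apply, smul_eq_mul] at h3
    have h4 : (6 * Complex.I / π : ℂ) *
        (((ModularGroup.S 1 0 : ℤ) : ℂ) / denom ModularGroup.S τ) * B τ = 0 := by
      linear_combination h3
    have hpi : (π : ℂ) ≠ 0 := by exact_mod_cast Real.pi_ne_zero
    have hd := denom_ne_zero ModularGroup.S τ
    have hS : ((ModularGroup.S 1 0 : ℤ) : ℂ) = 1 := by simp [ModularGroup.S]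
    rw [hS] at h4
    refine (mul_eq_zero.mp h4).resolve_left ?_
    exact mul_ne_zero (div_ne_zero (mul_ne_zero (by norm_num) Complex.I_ne_zero) hpi)
      (div_ne_zero one_ne_zero hd)
  refine ⟨?_, hB⟩
  rw [hB] at h
  ext τ
  simpa using congrFun h τ

/-- The parametrization of `QM w 1` by pairs of modular forms. -/
def pairMap (w : ℤ) : (ModularForm 𝒮ℒ w × ModularForm 𝒮ℒ (w - 2)) →ₗ[ℂ] (ℍ → ℂ) where
  toFun p := p.1 + E₂ * p.2
  map_add' p q := by ext; simp; ring
  map_smul' c p := by ext; simp; ring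

lemma range_pairMap (w : ℤ) : LinearMap.range (pairMap w) = QM w 1 := by
  ext f
  rw [mem_QM_one]
  constructor
  · rintro ⟨⟨A, B⟩, rfl⟩; exact ⟨A, B, rfl⟩
  · rintro ⟨A, B, rfl⟩; exact ⟨⟨A, B⟩, rfl⟩

lemma injective_pairMap (w : ℤ) : Function.Injective (pairMap w) := by
  rw [← LinearMap.ker_eq_bot, LinearMap.ker_eq_bot']
  rintro ⟨A, B⟩ h
  obtain ⟨rfl, rfl⟩ := eq_zero_of_add_E2_mul_eq_zero h
  rfl

lemma finrank_modularForm {k : ℕ} (hk : Even k) :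
    Module.finrank ℂ (ModularForm 𝒮ℒ k) = if k % 12 = 2 then k / 12 else k / 12 + 1 := by
  apply Module.finrank_eq_of_rank_eq
  rw [dimension_level_one k hk]
  norm_num [Nat.ModEq]

instance finiteDimensional_QM (w : ℤ) : FiniteDimensional ℂ (QM w 1) := by
  rw [← range_pairMap]; infer_instance

theorem finrank_QM {k : ℕ} (hk : Even k) (h2 : 2 ≤ k) :
    Module.finrank ℂ (QM k 1) = k / 6 + 1 := by
  rw [← range_pairMap, LinearMap.finrank_range_of_inj (injective_pairMap _),
    Module.finrank_prod, show (k : ℤ) - 2 = ((k - 2 : ℕ) : ℤ) by omega, finrank_modularForm hk,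
    finrank_modularForm (by obtain ⟨m, rfl⟩ := hk; exact ⟨m - 1, by omega⟩)]
  obtain ⟨m, rfl⟩ := hk
  split_ifs <;> omega

/-- The first coefficients of the `q`-expansion, as a linear map. -/
def coeffMap (k : ℕ) : QM k 1 →ₗ[ℂ] (Fin (k / 6 + 1) → ℂ) where
  toFun f i := coeff i (qExpansion 1 (f : ℍ → ℂ))
  map_add' f g := by
    ext i
    rw [Submodule.coe_add, (regular_of_mem_QM f.2).qExpansion_add (regular_of_mem_QM g.2)]
    simp
  map_smul' c f := by
    ext i
    rw [Submodule.coe_smul, (regular_of_mem_QM f.2).qExpansion_smul]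
    simp

lemma injective_coeffMap (k : ℕ) : Function.Injective (coeffMap k) := fun f g h =>
  Subtype.ext <| eq_of_coeff_eq f.2 g.2 fun i hi =>
    congrFun h (⟨i, Nat.lt_succ_of_le hi⟩ : Fin (k / 6 + 1))

/-- The coefficient map is injective by the vanishing bound and its source and target have equal
dimension, so any initial coefficients can be prescribed. -/
lemma exists_hasLeadingTerm {k : ℕ} (hk : Even k) (h2 : 2 ≤ k) :
    ∃ f ∈ QM k 1, HasLeadingTerm f (k / 6) := by
  have hs : Function.Surjective (coeffMap k) :=
    (LinearMap.injective_iff_surjective_of_finrank_eq_finrank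
      (by rw [finrank_QM hk h2]; simp)).mp (injective_coeffMap k)
  obtain ⟨f, hf⟩ := hs (Pi.single (Fin.last _) 1)
  refine ⟨f, f.2, hasLeadingTerm_of_coeff fun i hi => ?_⟩
  have := congrFun hf (⟨i, Nat.lt_succ_of_le hi⟩ : Fin (k / 6 + 1))
  rw [Pi.single_apply] at this
  simpa [coeffMap, Fin.ext_iff] using this

lemma notMem_QM_zero {k : ℕ} (h2 : 2 ≤ k) (h4 : k ≠ 4) (hk : Even k) {f : ℍ → ℂ}
    (hf : HasLeadingTerm f (k / 6)) : f ∉ QM k 0 := by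
  intro h
  obtain ⟨A, rfl⟩ := mem_QM_zero.mp h
  have hA : A = 0 := by
    -- The inequality k/12 < k/6 between integer parts fails only for k = 2 and k = 4: there is no
    -- modular form of weight 2, and E₄ is the reason for excluding weight 4.
    by_cases hk2 : k = 2
    · subst hk2
      exact rank_zero_iff_forall_zero.mp levelOne_weight_two_rank_zero A
    · apply sturm_bound_levelOne
      rw [hf.1, Int.toNat_natCast]
      have : k / 12 < k / 6 := by obtain ⟨m, rfl⟩ := hk; omega
      exact_mod_cast this
  have h1 := hf.2
  rw [hA, FunLike.coe_zero, qExpansion_zero] at h1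
  simp at h1

lemma isNormalizedExtremal_iff {k : ℕ} (hk : Even k) (h2 : 2 ≤ k) (h4 : k ≠ 4) {f : ℍ → ℂ} :
    IsNormalizedExtremal k 1 f ↔ f ∈ QM k 1 ∧ HasLeadingTerm f (k / 6) := by
  rw [IsNormalizedExtremal, finrank_QM hk h2]
  constructor
  · rintro ⟨h1, -, n, hn, h3⟩
    obtain rfl : n = k / 6 := by omega
    exact ⟨h1, h3⟩
  · rintro ⟨h1, h3⟩
    exact ⟨h1, by simpa using notMem_QM_zero h2 h4 hk h3, _, rfl, h3⟩

theorem existsUnique_isNormalizedExtremal {k : ℕ} (hk : Even k) (h2 : 2 ≤ k) (h4 : k ≠ 4) :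
    ∃! f : ℍ → ℂ, IsNormalizedExtremal k 1 f := by
  simp only [isNormalizedExtremal_iff hk h2 h4]
  obtain ⟨f, hf, hf'⟩ := exists_hasLeadingTerm hk h2
  exact ⟨f, ⟨hf, hf'⟩, fun g hg => HasLeadingTerm.unique hg.1 hf hg.2 hf'⟩

lemma G_spec {k : ℕ} (hk : Even k) (h2 : 2 ≤ k) (h4 : k ≠ 4) :
    G k ∈ QM k 1 ∧ HasLeadingTerm (G k) (k / 6) :=
  (isNormalizedExtremal_iff hk h2 h4).mp
    (Classical.epsilon_spec (existsUnique_isNormalizedExtremal hk h2 h4).exists)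

lemma eq_G {k : ℕ} (hk : Even k) (h2 : 2 ≤ k) (h4 : k ≠ 4) {f : ℍ → ℂ} (hf : f ∈ QM k 1)
    (hf' : HasLeadingTerm f (k / 6)) : f = G k :=
  HasLeadingTerm.unique hf (G_spec hk h2 h4).1 hf' (G_spec hk h2 h4).2

/-! ### Leading exponents and the triangular bases -/

lemma HasLeadingTerm.E4_mul {f : ℍ → ℂ} {n : ℕ} (hf : Regular f) (h : HasLeadingTerm f n) :
    HasLeadingTerm (E4 * f) n := by
  refine hasLeadingTerm_of_coeff fun i hi => ?_
  obtain ⟨u, hu⟩ : X ^ n ∣ qExpansion 1 f := X_pow_dvd_iff.mpr fun m hm => by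
    rw [h.coeff_eq hm.le, if_neg hm.ne]
  have h1 := h.2
  rw [hu, coeff_X_pow_mul', if_pos le_rfl, Nat.sub_self, coeff_zero_eq_constantCoeff_apply] at h1
  rw [regular_E4.qExpansion_mul hf, hu,
    show qExpansion 1 E4 * (X ^ n * u) = X ^ n * (qExpansion 1 E4 * u) by ring, coeff_X_pow_mul']
  split_ifs with h2 h3 h3
  · rw [h3, Nat.sub_self, coeff_zero_eq_constantCoeff_apply, map_mul, h1]
    rw [show constantCoeff (qExpansion 1 E4) = 1 from constantCoeff_qExpansion_E4, one_mul]
  · omega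
  · omega
  · rfl

lemma E4_mul_mem_QM {w : ℤ} {f : ℍ → ℂ} (hf : f ∈ QM w 1) : E4 * f ∈ QM (w + 4) 1 := by
  obtain ⟨A, B, rfl⟩ := mem_QM_one.mp hf
  refine mem_QM_one.mpr ⟨ModularForm.mcast (by ring) (E₄.mul A),
    ModularForm.mcast (by ring) (E₄.mul B), ?_⟩
  ext τ
  simp [E4]; ring

/-- `f` lies in `QM k 1` and has Fourier expansion `q ^ n + O(q ^ (n + 1))`. -/
def Leading (k n : ℕ) (f : ℍ → ℂ) : Prop := f ∈ QM k 1 ∧ HasLeadingTerm f n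

lemma Leading.E4_mul {k n : ℕ} {f : ℍ → ℂ} (h : Leading k n f) : Leading (k + 4) n (E4 * f) :=
  ⟨by push_cast; exact E4_mul_mem_QM h.1, h.2.E4_mul (regular_of_mem_QM h.1)⟩

lemma Leading.E4_pow_mul {k n : ℕ} {f : ℍ → ℂ} (h : Leading k n f) (e : ℕ) :
    Leading (k + 4 * e) n (E4 ^ e * f) := by
  induction e with
  | zero => simpa using h
  | succ e ih =>
    rw [pow_succ', mul_assoc, show k + 4 * (e + 1) = k + 4 * e + 4 by ring]
    exact ih.E4_mul

lemma leading_G {k : ℕ} (hk : Even k) (h2 : 2 ≤ k) (h4 : k ≠ 4) : Leading k (k / 6) (G k) :=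
  G_spec hk h2 h4

lemma leading_one : Leading 0 0 1 := by
  refine ⟨mem_QM_one.mpr ⟨ModularForm.mcast (by simp) (1 : ModularForm 𝒮ℒ 0), 0, by ext; simp⟩, hasLeadingTerm_of_coeff fun i hi => ?_⟩
  rw [UpperHalfPlane.qExpansion_one, coeff_one]

/-- The functions in `S` can be numbered `f 0, …, f N` such that `f n ∈ QM k 1` and
`f n = q ^ n + O(q ^ (n + 1))`. -/
def IsTriangular (k N : ℕ) (S : Set (ℍ → ℂ)) : Prop :=
  ∃ h : ℕ → ℍ → ℂ, S = h '' {i | i ≤ N} ∧ ∀ i ≤ N, Leading k i (h i)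

lemma IsTriangular.E4mul {k N : ℕ} {S : Set (ℍ → ℂ)} (hS : IsTriangular k N S) :
    IsTriangular (k + 4) N (E4mul S) := by
  obtain ⟨h, rfl, hh⟩ := hS
  exact ⟨fun i => E4 * h i, by rw [Quasimodular.E4mul, Set.image_image],
    fun i hi => (hh i hi).E4_mul⟩

lemma IsTriangular.union_singleton {k N : ℕ} {S : Set (ℍ → ℂ)} (hS : IsTriangular k N S)
    {g : ℍ → ℂ} (hg : Leading k (N + 1) g) : IsTriangular k (N + 1) (S ∪ {g}) := by
  obtain ⟨h, rfl, hh⟩ := hS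
  refine ⟨fun i => if i ≤ N then h i else g, ?_, fun i hi => ?_⟩
  · ext f
    simp only [Set.mem_union, Set.mem_image, Set.mem_ofPred_eq, Set.mem_singleton_iff]
    constructor
    · rintro (⟨i, hi, rfl⟩ | rfl)
      · exact ⟨i, by omega, if_pos hi⟩
      · exact ⟨N + 1, le_rfl, if_neg (by omega)⟩
    · rintro ⟨i, hi, rfl⟩
      by_cases h1 : i ≤ N
      · exact Or.inl ⟨i, h1, (if_pos h1).symm⟩
      · exact Or.inr (if_neg h1)
  · by_cases h1 : i ≤ N
    · simp only [if_pos h1]; exact hh i h1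
    · obtain rfl : i = N + 1 := by omega
      simp only [if_neg h1]; exact hg

/-- G_{12l} starts at q^(2l) and G_{12l+8} at q^(2l+1), while E₄ has constant term 1; so even
exponents come from the first family and odd ones from the second. -/
lemma isTriangular_basis0 (m : ℕ) : IsTriangular (12 * m) (2 * m) (basis0 m) := by
  refine ⟨fun i => if i = 0 then E4 ^ (3 * m) else
    if Even i then E4 ^ (3 * (m - i / 2)) * G (12 * (i / 2)) else
      E4 ^ (3 * (m - i / 2) - 2) * G (12 * (i / 2) + 8), ?_, fun i hi => ?_⟩
  · ext f
    simp only [basis0, Set.mem_union, Set.mem_image, Set.mem_ofPred_eq, Set.mem_singleton_iff]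
    constructor
    · rintro ((rfl | ⟨l, h1, h2, rfl⟩) | ⟨l, h1, rfl⟩)
      · exact ⟨0, by omega, if_pos rfl⟩
      · refine ⟨2 * l, by omega, ?_⟩
        rw [if_neg (by omega), if_pos (by simp), show 2 * l / 2 = l by omega]
      · refine ⟨2 * l + 1, by omega, ?_⟩
        rw [if_neg (by omega), if_neg (by simp), show (2 * l + 1) / 2 = l by omega]
    · rintro ⟨i, hi, rfl⟩
      split_ifs with h0 h1
      · exact Or.inl (Or.inl rfl)
      · obtain ⟨l, rfl⟩ := h1
        exact Or.inl (Or.inr ⟨(l + l) / 2, by omega, by omega, rfl⟩)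
      · obtain ⟨l, rfl⟩ := Nat.not_even_iff_odd.mp h1
        exact Or.inr ⟨(2 * l + 1) / 2, by omega, rfl⟩
  · simp only
    split_ifs with h0 h1
    · subst h0
      simpa [show 4 * (3 * m) = 12 * m by ring] using leading_one.E4_pow_mul (3 * m)
    · obtain ⟨l, rfl⟩ := h1
      have h := (leading_G (k := 12 * l) (by simp [parity_simps]) (by omega)
        (by omega)).E4_pow_mul (3 * (m - l))
      rw [show (l + l) / 2 = l by omega]
      convert h using 1 <;> omega
    · obtain ⟨l, rfl⟩ := Nat.not_even_iff_odd.mp h1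
      have h := (leading_G (k := 12 * l + 8) (by simp [parity_simps]) (by omega)
        (by omega)).E4_pow_mul (3 * (m - l) - 2)
      rw [show (2 * l + 1) / 2 = l by omega]
      convert h using 1 <;> omega

lemma isTriangular_basis2 (m : ℕ) : IsTriangular (12 * m + 2) (2 * m) (basis2 m) := by
  refine ⟨fun i => if Even i then E4 ^ (3 * (m - i / 2)) * G (12 * (i / 2) + 2) else
      E4 ^ (3 * (m - i / 2) - 2) * G (12 * (i / 2) + 10), ?_, fun i hi => ?_⟩
  · ext f
    simp only [basis2, Set.mem_union, Set.mem_image, Set.mem_ofPred_eq]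
    constructor
    · rintro (⟨l, h2, rfl⟩ | ⟨l, h1, rfl⟩)
      · refine ⟨2 * l, by omega, ?_⟩
        rw [if_pos (by simp), show 2 * l / 2 = l by omega]
      · refine ⟨2 * l + 1, by omega, ?_⟩
        rw [if_neg (by simp), show (2 * l + 1) / 2 = l by omega]
    · rintro ⟨i, hi, rfl⟩
      split_ifs with h1
      · obtain ⟨l, rfl⟩ := h1
        exact Or.inl ⟨(l + l) / 2, by omega, rfl⟩
      · obtain ⟨l, rfl⟩ := Nat.not_even_iff_odd.mp h1
        exact Or.inr ⟨(2 * l + 1) / 2, by omega, rfl⟩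
  · simp only
    split_ifs with h1
    · obtain ⟨l, rfl⟩ := h1
      have h := (leading_G (k := 12 * l + 2) (by simp [parity_simps]) (by omega)
        (by omega)).E4_pow_mul (3 * (m - l))
      rw [show (l + l) / 2 = l by omega]
      convert h using 1 <;> omega
    · obtain ⟨l, rfl⟩ := Nat.not_even_iff_odd.mp h1
      have h := (leading_G (k := 12 * l + 10) (by simp [parity_simps]) (by omega)
        (by omega)).E4_pow_mul (3 * (m - l) - 2)
      rw [show (2 * l + 1) / 2 = l by omega]
      convert h using 1 <;> omega

/-- Multiplication by E₄ preserves the exponents. Only at k ≡ 6 and k ≡ 8 mod 12 does this leave the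
top exponent k/6 uncovered, and there G_k is adjoined. -/
lemma isTriangular_extremalBasis {k : ℕ} (hk : Even k) (h2 : 2 ≤ k) :
    IsTriangular k (k / 6) (extremalBasis k) := by
  obtain ⟨m, r, hr, rfl⟩ : ∃ m r, r < 12 ∧ k = 12 * m + r :=
    ⟨k / 12, k % 12, Nat.mod_lt _ (by norm_num), by omega⟩
  have hr2 : Even r := by
    rw [Nat.even_add] at hk
    exact hk.mp (by simp [parity_simps])
  have hm : (12 * m + r) / 12 = m := by omega
  have hmod : (12 * m + r) % 12 = r := by omega
  have hB6 : IsTriangular (12 * m + 6) (2 * m + 1)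
      (E4mul (basis2 m) ∪ {G (12 * m + 6)}) := by
    refine (isTriangular_basis2 m).E4mul.union_singleton ?_
    have := leading_G (k := 12 * m + 6) (by simp [parity_simps]) (by omega)
      (by omega)
    rwa [show (12 * m + 6) / 6 = 2 * m + 1 by omega] at this
  unfold extremalBasis
  rw [hm, hmod]
  obtain ⟨s, rfl⟩ := hr2
  have hs : s < 6 := by omega
  interval_cases s <;> simp only [Nat.reduceAdd] <;> clear hm hmod hr
  · rw [show (12 * m + 0) / 6 = 2 * m by omega]
    exact isTriangular_basis0 m
  · rw [show (12 * m + 2) / 6 = 2 * m by omega]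
    exact isTriangular_basis2 m
  · rw [show (12 * m + 4) / 6 = 2 * m by omega]
    exact (isTriangular_basis0 m).E4mul
  · rw [show (12 * m + 6) / 6 = 2 * m + 1 by omega]
    exact hB6
  · rw [show (12 * m + 8) / 6 = 2 * m + 1 by omega]
    refine (isTriangular_basis0 m).E4mul.E4mul.union_singleton ?_
    have := leading_G (k := 12 * m + 8) hk h2 (by omega)
    rwa [show (12 * m + 8) / 6 = 2 * m + 1 by omega] at this
  · rw [show (12 * m + 10) / 6 = 2 * m + 1 by omega]
    exact hB6.E4mul

lemma qExpansion_sum {ι : Type*} (s : Finset ι) (f : ι → ℍ → ℂ) (c : ι → ℂ)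
    (hf : ∀ i ∈ s, Regular (f i)) :
    Regular (∑ i ∈ s, c i • f i) ∧
      qExpansion 1 (∑ i ∈ s, c i • f i) = ∑ i ∈ s, C (c i) * qExpansion 1 (f i) := by
  classical
  induction s using Finset.induction_on with
  | empty => exact ⟨regular_modularForm (0 : ModularForm 𝒮ℒ 0), qExpansion_zero 1⟩
  | insert a s ha ih =>
    obtain ⟨h1, h2⟩ := ih fun i hi => hf i (Finset.mem_insert_of_mem hi)
    have h3 := hf a (Finset.mem_insert_self a s)
    rw [Finset.sum_insert ha, Finset.sum_insert ha]
    exact ⟨(h3.smul _).add h1, by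
      rw [(h3.smul _).qExpansion_add h1, h3.qExpansion_smul, h2]⟩

lemma linearIndependent_of_leading {k d : ℕ} (v : Fin d → QM k 1)
    (hv : ∀ i, HasLeadingTerm (v i : ℍ → ℂ) i) : LinearIndependent ℂ v := by
  rw [Fintype.linearIndependent_iff]
  intro c hc
  by_contra! hne
  obtain ⟨i₀, hi₀⟩ := hne
  -- At the least index i with nonzero coefficient, the q^i term of the relation comes from the i-th
  -- form alone.
  obtain ⟨i, hi, hmin⟩ := WellFounded.has_min (wellFounded_lt (α := Fin d)) {i | c i ≠ 0} ⟨i₀, hi₀⟩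
  have h1 : (∑ j, c j • (v j : ℍ → ℂ)) = 0 := by
    have := congrArg (Subtype.val) hc
    simpa using this
  have h2 := (qExpansion_sum Finset.univ (fun j => (v j : ℍ → ℂ)) c
    fun j _ => regular_of_mem_QM (v j).2).2
  rw [h1, qExpansion_zero] at h2
  have h3 := congrArg (coeff (i : ℕ)) h2
  rw [map_zero, map_sum, Finset.sum_eq_single i] at h3
  · rw [coeff_C_mul, (hv i).coeff_eq le_rfl, if_pos rfl, mul_one] at h3
    exact hi h3.symm
  · intro j _ hj
    rw [coeff_C_mul]
    rcases lt_or_gt_of_ne hj with hlt | hgt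
    · have : c j = 0 := by
        by_contra h
        exact hmin j h hlt
      rw [this, zero_mul]
    · rw [(hv j).coeff_eq hgt.le, if_neg (by simpa [Fin.ext_iff] using hj.symm), mul_zero]
  · simp

theorem exists_basis_range_eq_extremalBasis {k : ℕ} (hk : Even k) (h2 : 2 ≤ k) :
    ∃ b : Module.Basis (Fin (Module.finrank ℂ (QM (k : ℤ) 1))) ℂ (QM (k : ℤ) 1),
      Set.range (fun i => (b i : ℍ → ℂ)) = extremalBasis k ∧
      ∀ i, HasLeadingTerm (b i : ℍ → ℂ) (i : ℕ) := by
  obtain ⟨h, hS, hh⟩ := isTriangular_extremalBasis hk h2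
  have hd := finrank_QM hk h2
  let v : Fin (Module.finrank ℂ (QM (k : ℤ) 1)) → QM (k : ℤ) 1 :=
    fun i => ⟨h i, (hh i (by omega)).1⟩
  have hv : ∀ i, HasLeadingTerm (v i : ℍ → ℂ) i := fun i => (hh i (by omega)).2
  have : Nonempty (Fin (Module.finrank ℂ (QM (k : ℤ) 1))) := ⟨⟨0, by omega⟩⟩
  refine ⟨basisOfLinearIndependentOfCardEqFinrank (linearIndependent_of_leading v hv) (by simp),
    ?_, fun i => ?_⟩
  · rw [hS, coe_basisOfLinearIndependentOfCardEqFinrank]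
    ext f
    constructor
    · rintro ⟨i, rfl⟩
      exact ⟨i, by have := i.2; simp only [Set.mem_ofPred_eq]; omega, rfl⟩
    · rintro ⟨i, hi, rfl⟩
      simp only [Set.mem_ofPred_eq] at hi
      exact ⟨⟨i, by omega⟩, rfl⟩
  · rw [coe_basisOfLinearIndependentOfCardEqFinrank]
    exact hv i

end

/-! ### The first order system for the extremal forms of weights 6n and 6n+2 -/

section
open UpperHalfPlane Filter Topology PowerSeries Derivative ModularForm
open scoped Manifold Real

local notation "E₂" => EisensteinSeries.E2

lemma coeff_mul_of_forall_lt {x : PowerSeries ℂ} {m : ℕ} (h : ∀ i < m, coeff i x = 0)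
    (e : PowerSeries ℂ) {i : ℕ} (hi : i ≤ m) :
    coeff i (e * x) = constantCoeff e * coeff i x := by
  obtain ⟨u, rfl⟩ := X_pow_dvd_iff.mpr h
  rw [show e * (X ^ m * u) = X ^ m * (e * u) by ring, coeff_X_pow_mul', coeff_X_pow_mul']
  split_ifs with h1
  · obtain rfl : i = m := by omega
    simp
  · simp

lemma Leading.coeff_serreDerivative {k n : ℕ} {f : ℍ → ℂ} (h : Leading k n f) {i : ℕ} (hi : i ≤ n) :
    coeff i (qExpansion 1 (serreDerivative ((k : ℂ) - 1) f)) =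
      if i = n then (n : ℂ) - (k - 1) / 12 else 0 := by
  have hlt : ∀ i < n, coeff i (qExpansion 1 f) = 0 := fun i hi => by
    rw [h.2.coeff_eq hi.le, if_neg hi.ne]
  rw [(regular_of_mem_QM h.1).qExpansion_serreDerivative, map_sub, coeff_theta, coeff_C_mul,
    coeff_mul_of_forall_lt hlt _ hi, constantCoeff_qExpansion_E2, h.2.coeff_eq hi]
  split_ifs with h1
  · rw [h1]; ring
  · simp

/-- The parameter w − 1 is the one for which the E₂² terms cancel: 1/12 + (w−2)/12 − (w−1)/12 = 0.
-/
lemma serreDerivative_mem_QM {w : ℤ} {f : ℍ → ℂ} (hf : f ∈ QM w 1) :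
    serreDerivative ((w : ℂ) - 1) f ∈ QM (w + 2) 1 := by
  obtain ⟨A, B, rfl⟩ := mem_QM_one.mp hf
  refine mem_QM_one.mpr
    ⟨serreForm A - (12⁻¹ : ℂ) • ModularForm.mcast (by ring) (E₄.mul B),
      ModularForm.mcast (by ring) (serreForm B) +
        (12⁻¹ : ℂ) • ModularForm.mcast (by ring) A, ?_⟩
  have hA := regular_modularForm A
  have hB := regular_modularForm B
  ext τ
  rw [serreDerivative_apply, normalizedDerivOfComplex_add _ _ hA.mdiff
    (regular_E2.mul hB).mdiff, normalizedDerivOfComplex_mul _ _ regular_E2.mdiff hB.mdiff, D_E2]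
  simp only [Pi.add_apply, Pi.mul_apply, Pi.smul_apply, smul_eq_mul, D_modularForm]
  simp [E4]
  ring

/-- The extremal form of weight `6 n` and depth at most `1`. -/
def extremal0 (n : ℕ) : ℍ → ℂ := if n = 0 then 1 else G (6 * n)

/-- The extremal form of weight `6 n + 2` and depth `1`. -/
def extremal2 (n : ℕ) : ℍ → ℂ := G (6 * n + 2)

lemma leading_extremal0 (n : ℕ) : Leading (6 * n) n (extremal0 n) := by
  unfold extremal0
  split_ifs with h
  · subst h; exact leading_one
  · have := leading_G (k := 6 * n) (by simp [parity_simps]) (by omega) (by omega)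
    rwa [show 6 * n / 6 = n by omega] at this

lemma leading_extremal2 (n : ℕ) : Leading (6 * n + 2) n (extremal2 n) := by
  have := leading_G (k := 6 * n + 2) (by simp [parity_simps]) (by omega) (by omega)
  rwa [show (6 * n + 2) / 6 = n by omega] at this

/-- Since n is the last exponent that matters in weight k + 2, two forms vanishing below qⁿ there
are proportional. The factor is the effect of θ − (k−1)/12 · E₂ on the leading coefficient. -/
lemma Leading.serreDerivative_eq {k n : ℕ} {f g : ℍ → ℂ} (hf : Leading k n f)
    (hg : Leading (k + 2) n g) (hn : (k + 2) / 6 = n) :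
    serreDerivative ((k : ℂ) - 1) f = ((n : ℂ) - (k - 1) / 12) • g := by
  have hm : serreDerivative ((k : ℂ) - 1) f ∈ QM ((k + 2 : ℕ) : ℤ) 1 := by
    have := serreDerivative_mem_QM hf.1
    push_cast at this ⊢
    exact this
  refine eq_of_coeff_eq (k := k + 2) hm (Submodule.smul_mem _ _ hg.1) fun i hi => ?_
  rw [hn] at hi
  rw [hf.coeff_serreDerivative hi, (regular_of_mem_QM hg.1).qExpansion_smul, coeff_C_mul, hg.2.coeff_eq hi]
  split_ifs <;> simp

lemma theta_extremal0 (n : ℕ) : theta (qExpansion 1 (extremal0 n)) =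
    C ((6 * n - 1) / 12 : ℂ) * (qExpansion 1 E₂ * qExpansion 1 (extremal0 n)) +
      C ((6 * n + 1) / 12 : ℂ) * qExpansion 1 (extremal2 n) := by
  have h := (leading_extremal0 n).serreDerivative_eq (leading_extremal2 n) (by omega)
  have h1 := (regular_of_mem_QM (leading_extremal0 n).1).qExpansion_serreDerivative
    (((6 * n : ℕ) : ℂ) - 1)
  rw [h, (regular_of_mem_QM (leading_extremal2 n).1).qExpansion_smul, eq_sub_iff_add_eq] at h1
  rw [← h1, add_comm]
  push_cast
  congr 3; ring

lemma theta_extremal2 (n : ℕ) : theta (qExpansion 1 (extremal2 n)) =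
    C ((6 * n + 1) / 12 : ℂ) * (qExpansion 1 E₂ * qExpansion 1 (extremal2 n)) +
      C ((6 * n - 1) / 12 : ℂ) * (qExpansion 1 E4 * qExpansion 1 (extremal0 n)) := by
  have hX := (leading_extremal0 n).E4_mul
  have h := (leading_extremal2 n).serreDerivative_eq hX (by omega)
  have h1 := (regular_of_mem_QM (leading_extremal2 n).1).qExpansion_serreDerivative
    (((6 * n + 2 : ℕ) : ℂ) - 1)
  rw [h, (regular_of_mem_QM hX.1).qExpansion_smul, eq_sub_iff_add_eq,
    regular_E4.qExpansion_mul (regular_of_mem_QM (leading_extremal0 n).1)] at h1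
  rw [← h1, add_comm]
  push_cast
  congr 3 <;> ring

/-- The exponents at q = 0 are the eigenvalues 0 and a + b = n of the constant-term matrix. Beyond
qⁿ the recursion is thus invertible. -/
lemma eq_zero_of_theta_system {n : ℕ} {e e' x y : PowerSeries ℂ} (he : constantCoeff e = 1)
    (he' : constantCoeff e' = 1) {a b : ℂ} (hab : a + b = n)
    (hx : theta x = C a * (e * x) + C b * y) (hy : theta y = C b * (e * y) + C a * (e' * x))
    (hx0 : ∀ i ≤ n, coeff i x = 0) (hy0 : ∀ i ≤ n, coeff i y = 0) : x = 0 ∧ y = 0 := by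
  suffices h : ∀ m, coeff m x = 0 ∧ coeff m y = 0 from
    ⟨by ext m; simp [h m], by ext m; simp [h m]⟩
  intro m
  induction m using Nat.strong_induction_on with
  | _ m ih =>
    by_cases hm : m ≤ n
    · exact ⟨hx0 m hm, hy0 m hm⟩
    have h1 := congrArg (coeff m) hx
    have h2 := congrArg (coeff m) hy
    have hxl : ∀ i < m, coeff i x = 0 := fun i hi => (ih i hi).1
    have hyl : ∀ i < m, coeff i y = 0 := fun i hi => (ih i hi).2
    rw [coeff_theta, map_add, coeff_C_mul, coeff_C_mul, coeff_mul_of_forall_lt hxl _ le_rfl, he]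
      at h1
    rw [coeff_theta, map_add, coeff_C_mul, coeff_C_mul, coeff_mul_of_forall_lt hxl _ le_rfl,
      coeff_mul_of_forall_lt hyl _ le_rfl, he, he'] at h2
    have hm0 : (m : ℂ) ≠ 0 := by
      have : m ≠ 0 := by omega
      exact_mod_cast this
    have hmn : (m : ℂ) - n ≠ 0 := sub_ne_zero.mpr (by
      have : m ≠ n := by omega
      exact_mod_cast this)
    -- The two equations have the same right side a·x_m + b·y_m at the lowest surviving index.
    have h3 : coeff m x = coeff m y := by
      apply mul_left_cancel₀ hm0
      linear_combination h1 - h2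
    have h4 : coeff m x = 0 := by
      apply mul_left_cancel₀ hmn
      rw [← h3] at h1
      linear_combination h1 + coeff m x * hab
    exact ⟨h4, h3 ▸ h4⟩

/-- `f` is differentiable at `q` and `q f'(q) = v`. -/
def HasTheta (f : ℂ → ℂ) (v q : ℂ) : Prop := ∃ f', HasDerivAt f f' q ∧ q * f' = v

namespace HasTheta

variable {f g : ℂ → ℂ} {v w q : ℂ}

lemma eq (h : HasTheta f v q) : q * deriv f q = v := by
  obtain ⟨f', hf, rfl⟩ := h
  rw [hf.deriv]

lemma congr_val (h : HasTheta f v q) (hvw : v = w) : HasTheta f w q := hvw ▸ h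

lemma mul (hf : HasTheta f v q) (hg : HasTheta g w q) :
    HasTheta (fun z => f z * g z) (v * g q + f q * w) q := by
  obtain ⟨f', hf, rfl⟩ := hf
  obtain ⟨g', hg, rfl⟩ := hg
  exact ⟨_, hf.mul hg, by ring⟩

lemma add (hf : HasTheta f v q) (hg : HasTheta g w q) :
    HasTheta (fun z => f z + g z) (v + w) q := by
  obtain ⟨f', hf, rfl⟩ := hf
  obtain ⟨g', hg, rfl⟩ := hg
  exact ⟨_, hf.add hg, by ring⟩

lemma const_mul (c : ℂ) (hf : HasTheta f v q) : HasTheta (fun z => c * f z) (c * v) q := by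
  obtain ⟨f', hf, rfl⟩ := hf
  exact ⟨_, hf.const_mul c, by ring⟩

lemma div (hf : HasTheta f v q) (hg : HasTheta g w q) (h0 : g q ≠ 0) :
    HasTheta (fun z => f z / g z) ((v * g q - f q * w) / g q ^ 2) q := by
  obtain ⟨f', hf, rfl⟩ := hf
  obtain ⟨g', hg, rfl⟩ := hg
  exact ⟨_, hf.div hg h0, by ring⟩

lemma pow_eq (hf : HasTheta f v q) (hv : v = f q * w) (n : ℕ) :
    HasTheta (fun z => f z ^ n) (n * w * f q ^ n) q := by
  obtain ⟨f', hf, rfl⟩ := hf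
  refine ⟨_, hf.pow n, ?_⟩
  rcases n with _ | n
  · simp
  · rw [show q * ((n + 1 : ℕ) * f q ^ (n + 1 - 1) * f') = (n + 1 : ℕ) * f q ^ n * (q * f') by
      rw [Nat.add_sub_cancel]; ring, hv]
    ring

lemma comp {φ : ℂ → ℂ} {φ' : ℂ} (hφ : HasDerivAt φ φ' (f q)) (hf : HasTheta f v q) :
    HasTheta (fun z => φ (f z)) (φ' * v) q := by
  obtain ⟨f', hf, rfl⟩ := hf
  exact ⟨_, HasDerivAt.comp q hφ hf, by ring⟩

end HasTheta

lemma hasTheta_of_analyticAt {f : ℂ → ℂ} {q : ℂ} (hf : AnalyticAt ℂ f q) :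
    HasTheta f (q * deriv f q) q := ⟨_, hf.differentiableAt.hasDerivAt, rfl⟩

end

/-! ### Differential equations near q = 0 and removal of E₂ -/

section
open UpperHalfPlane Filter Topology PowerSeries Derivative ModularForm
open scoped Manifold Real Nat

local notation "E₂" => EisensteinSeries.E2

/-- `E₂` as a function of `q`. -/
def qE2 : ℂ → ℂ := cuspFunction 1 E₂

/-- `E₄` as a function of `q`. -/
def qE4 : ℂ → ℂ := cuspFunction 1 E4

/-- `E₆` as a function of `q`. -/
def qE6 : ℂ → ℂ := cuspFunction 1 E₆

/-- `1 / j` as a function of `q`. -/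
def qJInv (q : ℂ) : ℂ := (1 - qE6 q ^ 2 / qE4 q ^ 3) / 1728

/-- The fourth root of `E₄` as a function of `q`. -/
def qE4Root (q : ℂ) : ℂ := qE4 q ^ (1 / 4 : ℂ)

lemma regular_E6 : Regular E₆ := regular_modularForm E₆

lemma analyticAt_qE2 : AnalyticAt ℂ qE2 0 := regular_E2.analyticAt

lemma analyticAt_qE4 : AnalyticAt ℂ qE4 0 := regular_E4.analyticAt

lemma analyticAt_qE6 : AnalyticAt ℂ qE6 0 := regular_E6.analyticAt

lemma qE4_zero : qE4 0 = 1 :=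
  (constantCoeff_taylor _).symm.trans constantCoeff_qExpansion_E4

lemma qE6_zero : qE6 0 = 1 :=
  (constantCoeff_taylor _).symm.trans constantCoeff_qExpansion_E6

lemma qJInv_zero : qJInv 0 = 0 := by simp [qJInv, qE4_zero, qE6_zero]

lemma qE4Root_zero : qE4Root 0 = 1 := by simp [qE4Root, qE4_zero]

lemma qE4_zero_mem_slitPlane : qE4 0 ∈ Complex.slitPlane := by simp [qE4_zero]

lemma analyticAt_qJInv : AnalyticAt ℂ qJInv 0 :=
  (analyticAt_const.sub ((analyticAt_qE6.pow 2).div (analyticAt_qE4.pow 3)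
    (by simp [qE4_zero]))).div analyticAt_const (by norm_num)

lemma analyticAt_qE4Root : AnalyticAt ℂ qE4Root 0 :=
  analyticAt_qE4.cpow analyticAt_const qE4_zero_mem_slitPlane

/-- The differential equations satisfied near `q = 0` by `E₄`, `E₆`, `E₄ ^ (1 / 4)` and `1 / j`. -/
structure ThetaEquations (q : ℂ) : Prop where
  root_ne : qE4Root q ≠ 0
  root_pow : qE4Root q ^ 4 = qE4 q
  hE4 : HasTheta qE4 ((qE2 q * qE4 q - qE6 q) / 3) q
  hE6 : HasTheta qE6 ((qE2 q * qE6 q - qE4 q ^ 2) / 2) q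
  hRoot : HasTheta qE4Root (qE4Root q * ((qE2 q - qE6 q / qE4 q) / 12)) q
  hJInv : HasTheta qJInv (qJInv q * (qE6 q / qE4 q)) q

lemma ThetaEquations.E4_ne {q : ℂ} (h : ThetaEquations q) : qE4 q ≠ 0 := by
  rw [← h.root_pow]; exact pow_ne_zero _ h.root_ne

lemma eventually_hasTheta_qE4 :
    ∀ᶠ q in 𝓝 0, HasTheta qE4 ((qE2 q * qE4 q - qE6 q) / 3) q := by
  have h1 := cuspFunction_eventuallyEq regular_E4.D
    (g := fun q => (qE2 q * qE4 q - qE6 q) / 3)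
    (((analyticAt_qE2.mul analyticAt_qE4).sub analyticAt_qE6).div analyticAt_const
      (by norm_num)).continuousAt (fun τ => by
        rw [D_E4, regular_E2.eq_cuspFunction, regular_E4.eq_cuspFunction,
          regular_E6.eq_cuspFunction]; rfl)
  filter_upwards [analyticAt_qE4.eventually_analyticAt, h1, regular_E4.cuspFunction_D]
    with q hq h1 h2
  exact (hasTheta_of_analyticAt hq).congr_val (h2.symm.trans h1)

lemma eventually_hasTheta_qE6 :
    ∀ᶠ q in 𝓝 0, HasTheta qE6 ((qE2 q * qE6 q - qE4 q ^ 2) / 2) q := by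
  have h1 := cuspFunction_eventuallyEq regular_E6.D
    (g := fun q => (qE2 q * qE6 q - qE4 q ^ 2) / 2)
    (((analyticAt_qE2.mul analyticAt_qE6).sub (analyticAt_qE4.pow 2)).div analyticAt_const
      (by norm_num)).continuousAt (fun τ => by
        rw [D_E6, regular_E2.eq_cuspFunction, regular_E4.eq_cuspFunction,
          regular_E6.eq_cuspFunction]; rfl)
  filter_upwards [analyticAt_qE6.eventually_analyticAt, h1, regular_E6.cuspFunction_D]
    with q hq h1 h2
  exact (hasTheta_of_analyticAt hq).congr_val (h2.symm.trans h1)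

lemma eventually_thetaEquations : ∀ᶠ q in 𝓝 0, ThetaEquations q := by
  have hs : ∀ᶠ q in 𝓝 0, qE4 q ∈ Complex.slitPlane :=
    analyticAt_qE4.continuousAt.eventually_mem
      (Complex.isOpen_slitPlane.mem_nhds qE4_zero_mem_slitPlane)
  filter_upwards [hs, eventually_hasTheta_qE4, eventually_hasTheta_qE6] with q hq h4 h6
  have h0 : qE4 q ≠ 0 := Complex.slitPlane_ne_zero hq
  refine ⟨?_, ?_, h4, h6, ?_, ?_⟩
  · simp [qE4Root, Complex.cpow_eq_zero_iff, h0]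
  · rw [qE4Root, ← Complex.cpow_nat_mul]; simp
  · obtain ⟨f', hf, hv⟩ := h4
    refine ⟨_, hf.cpow_const hq, ?_⟩
    rw [Complex.cpow_sub _ _ h0, Complex.cpow_one, ← qE4Root,
      show q * (1 / 4 * (qE4Root q / qE4 q) * f') = 1 / 4 * (qE4Root q / qE4 q) * (q * f') by ring,
      hv]
    field_simp
    ring
  · have hc : HasTheta (fun _ : ℂ => (1 : ℂ)) 0 q := ⟨0, hasDerivAt_const _ _, mul_zero _⟩
    have h := (hc.add (((h6.mul h6).div ((h4.mul h4).mul h4) (by simp [h0])).const_mul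
      (-1))).const_mul (1 / 1728)
    have he : qJInv = fun z => 1 / 1728 *
        (1 + -1 * (qE6 z * qE6 z / (qE4 z * qE4 z * qE4 z))) := by
      ext z; simp only [qJInv]; ring
    rw [he]
    refine h.congr_val ?_
    field_simp
    ring

lemma discriminant_eq_smul : (ModularForm.discriminant : ℍ → ℂ) =
    (1728⁻¹ : ℂ) • (E4 * E4 * E4 + (-1 : ℂ) • (E₆ * E₆) : ℍ → ℂ) := by
  ext τ
  rw [discriminant_eq_E₄_cube_sub_E₆_sq]
  simp [E4]
  ring

lemma regular_discriminant : Regular ModularForm.discriminant := by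
  rw [discriminant_eq_smul]
  exact (((regular_E4.mul regular_E4).mul regular_E4).add
    ((regular_E6.mul regular_E6).smul _)).smul _

/-- The normalization comes from Δ = E₄³ · (1/j) and Δ = q + O(q²). -/
lemma exists_taylor_qJInv_eq : ∃ p, taylor qJInv = X * p ∧ constantCoeff p = 1 := by
  have h0 : constantCoeff (taylor qJInv) = 0 := by rw [constantCoeff_taylor, qJInv_zero]
  obtain ⟨p, hp⟩ := X_dvd_iff.mpr h0
  refine ⟨p, hp, ?_⟩
  have h1 : cuspFunction 1 ModularForm.discriminant =ᶠ[𝓝 0] fun q => qE4 q ^ 3 * qJInv q := by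
    have := cuspFunction_eventuallyEq regular_discriminant
      (g := fun q => 1728⁻¹ * (qE4 q * qE4 q * qE4 q + (-1) * (qE6 q * qE6 q)))
      (analyticAt_const.mul (((analyticAt_qE4.mul analyticAt_qE4).mul analyticAt_qE4).add
        (analyticAt_const.mul (analyticAt_qE6.mul analyticAt_qE6)))).continuousAt (fun τ => by
        rw [discriminant_eq_smul]
        simp only [Pi.smul_apply, Pi.add_apply, Pi.mul_apply, smul_eq_mul,
          regular_E4.eq_cuspFunction, regular_E6.eq_cuspFunction]
        rfl)
    filter_upwards [this, eventually_thetaEquations] with q h2 h3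
    rw [h2, qJInv]
    have := h3.E4_ne
    field_simp
    ring
  have h2 := discriminant_qExpansion_coeff_one
  rw [qExpansion_eq_taylor, taylor_congr h1,
    taylor_mul (f := fun q => qE4 q ^ 3) (analyticAt_qE4.pow 3) analyticAt_qJInv,
    coeff_mul_of_forall_lt (m := 1) (fun i hi => by
      obtain rfl : i = 0 := by omega
      rw [coeff_zero_eq_constantCoeff_apply, h0]) _ le_rfl, constantCoeff_taylor, qE4_zero, hp,
    show (1 : ℕ) = 0 + 1 from rfl, coeff_succ_X_mul, coeff_zero_eq_constantCoeff_apply] at h2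
  simpa using h2

lemma coeff_X_pow_mul_of_constantCoeff {n : ℕ} {w : PowerSeries ℂ} (hw : constantCoeff w = 1)
    {i : ℕ} (hi : i ≤ n) : coeff i (X ^ n * w) = if i = n then 1 else 0 := by
  rw [coeff_X_pow_mul']
  split_ifs with h1 h2 h2
  · rw [h2, Nat.sub_self, coeff_zero_eq_constantCoeff_apply, hw]
  · omega
  · omega
  · rfl

lemma coeff_taylor_mul_qJInv_pow (n : ℕ) {f g : ℂ → ℂ} (hf : AnalyticAt ℂ f 0)
    (hg : AnalyticAt ℂ g 0) (hf0 : f 0 = 1) (hg0 : g 0 = 1) {i : ℕ} (hi : i ≤ n) :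
    coeff i (taylor fun q => f q * (qJInv q ^ n * g q)) = if i = n then 1 else 0 := by
  obtain ⟨p, hp, hp0⟩ := exists_taylor_qJInv_eq
  rw [taylor_mul (g := fun q => qJInv q ^ n * g q) hf ((analyticAt_qJInv.pow n).mul hg),
    taylor_mul (f := fun q => qJInv q ^ n) (analyticAt_qJInv.pow n) hg,
    taylor_pow analyticAt_qJInv, hp,
    show taylor f * ((X * p) ^ n * taylor g) = X ^ n * (taylor f * p ^ n * taylor g) by ring]
  refine coeff_X_pow_mul_of_constantCoeff ?_ hi
  simp [constantCoeff_taylor, hf0, hg0, hp0]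

lemma taylor_linear {f g : ℂ → ℂ} (hf : AnalyticAt ℂ f 0) (hg : AnalyticAt ℂ g 0) (a b : ℂ) :
    taylor (fun z => a * f z + b * g z) = C a * taylor f + C b * taylor g := by
  rw [taylor_add (f := fun z => a * f z) (g := fun z => b * g z) (analyticAt_const.mul hf)
    (analyticAt_const.mul hg), taylor_const_mul, taylor_const_mul]

/-- The logarithmic θ-derivatives of g = E₄^(1/4) and 1/j are (E₂ − E₆/E₄)/12 and E₆/E₄, so the
prefactors produce exactly the E₂ terms of the system. The exponent 6n − 1 is written as a quotient
because it is negative for n = 0. -/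
theorem extremal_eventuallyEq_of_system (n : ℕ) {u v : ℂ → ℂ} (hu : AnalyticAt ℂ u 0)
    (hv : AnalyticAt ℂ v 0) (hu0 : u 0 = 1) (hv0 : v 0 = 1)
    (h : ∀ᶠ q in 𝓝 0,
      HasTheta u ((6 * n + 1) / 12 * (qE4Root q ^ 2 * v q - qE6 q / qE4 q * u q)) q ∧
      HasTheta v ((6 * n - 1) / 12 * (qE4Root q ^ 2 * u q - qE6 q / qE4 q * v q)) q) :
    (cuspFunction 1 (extremal0 n) =ᶠ[𝓝 0]
      fun q => qE4Root q ^ (6 * n) / qE4Root q * (qJInv q ^ n * u q)) ∧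
    (cuspFunction 1 (extremal2 n) =ᶠ[𝓝 0]
      fun q => qE4Root q ^ (6 * n) * qE4Root q * (qJInv q ^ n * v q)) := by
  set x : ℂ → ℂ := fun q => qE4Root q ^ (6 * n) / qE4Root q * (qJInv q ^ n * u q) with hx
  set y : ℂ → ℂ := fun q => qE4Root q ^ (6 * n) * qE4Root q * (qJInv q ^ n * v q) with hy
  have hf : AnalyticAt ℂ (fun q => qE4Root q ^ (6 * n) / qE4Root q) 0 :=
    (analyticAt_qE4Root.pow _).div analyticAt_qE4Root (by simp [qE4Root_zero])
  have hg : AnalyticAt ℂ (fun q => qE4Root q ^ (6 * n) * qE4Root q) 0 :=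
    (analyticAt_qE4Root.pow _).mul analyticAt_qE4Root
  have hxa : AnalyticAt ℂ x 0 := hf.mul ((analyticAt_qJInv.pow n).mul hu)
  have hya : AnalyticAt ℂ y 0 := hg.mul ((analyticAt_qJInv.pow n).mul hv)
  have hX := regular_of_mem_QM (leading_extremal0 n).1
  have hY := regular_of_mem_QM (leading_extremal2 n).1
  have hxθ : theta (taylor x) = C ((6 * n - 1) / 12 : ℂ) * (taylor qE2 * taylor x) +
      C ((6 * n + 1) / 12 : ℂ) * taylor y := by
    rw [← taylor_mul analyticAt_qE2 hxa, ← taylor_linear (f := fun z => qE2 z * x z) (analyticAt_qE2.mul hxa) hya,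
      ← taylor_theta hxa]
    refine taylor_congr ?_
    filter_upwards [h, eventually_thetaEquations] with q h1 h3
    obtain ⟨h1, -⟩ := h1
    have h0 := h3.root_ne
    have := ((((h3.hRoot.pow_eq rfl (6 * n)).div h3.hRoot h0).mul
      ((h3.hJInv.pow_eq rfl n).mul h1))).eq
    rw [hx, this, hy]
    push_cast
    field_simp
    ring
  have hyθ : theta (taylor y) = C ((6 * n + 1) / 12 : ℂ) * (taylor qE2 * taylor y) +
      C ((6 * n - 1) / 12 : ℂ) * (taylor qE4 * taylor x) := by
    rw [← taylor_mul analyticAt_qE2 hya, ← taylor_mul analyticAt_qE4 hxa,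
      ← taylor_linear (f := fun z => qE2 z * y z) (g := fun z => qE4 z * x z)
        (analyticAt_qE2.mul hya) (analyticAt_qE4.mul hxa), ← taylor_theta hya]
    refine taylor_congr ?_
    filter_upwards [h, eventually_thetaEquations] with q h1 h3
    obtain ⟨-, h1⟩ := h1
    have h0 := h3.root_ne
    have := ((((h3.hRoot.pow_eq rfl (6 * n)).mul h3.hRoot).mul
      ((h3.hJInv.pow_eq rfl n).mul h1))).eq
    rw [hy, this, hx]
    simp only [← h3.root_pow]
    push_cast
    field_simp
    ring
  have hXθ := theta_extremal0 n
  have hYθ := theta_extremal2 n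
  -- Both pairs solve the same system and begin with qⁿ, so their difference vanishes through order
  -- n.
  have key := eq_zero_of_theta_system (n := n) (e := taylor qE2) (e' := taylor qE4)
    (x := qExpansion 1 (extremal0 n) - taylor x) (y := qExpansion 1 (extremal2 n) - taylor y)
    constantCoeff_qExpansion_E2 constantCoeff_qExpansion_E4
    (a := (6 * n - 1) / 12) (b := (6 * n + 1) / 12) (by ring)
    (by
      rw [sub_eq_add_neg, theta_add, ← neg_one_mul, theta_mul, hXθ, hxθ,
        show theta (-1) = 0 by rw [theta_eq]; simp]
      simp only [qExpansion_eq_taylor, qE2]; ring)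
    (by
      rw [sub_eq_add_neg, theta_add, ← neg_one_mul, theta_mul, hYθ, hyθ,
        show theta (-1) = 0 by rw [theta_eq]; simp]
      simp only [qExpansion_eq_taylor, qE2, qE4]; ring)
    (fun i hi => by
      rw [map_sub, (leading_extremal0 n).2.coeff_eq hi,
        coeff_taylor_mul_qJInv_pow n hf hu (by simp [qE4Root_zero]) hu0 hi, sub_self])
    (fun i hi => by
      rw [map_sub, (leading_extremal2 n).2.coeff_eq hi,
        coeff_taylor_mul_qJInv_pow n hg hv (by simp [qE4Root_zero]) hv0 hi, sub_self])
  exact ⟨eventually_eq_of_taylor_eq hX.analyticAt hxa (sub_eq_zero.mp key.1),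
    eventually_eq_of_taylor_eq hY.analyticAt hya (sub_eq_zero.mp key.2)⟩

end

/-! ### The hypergeometric equation -/

section
open UpperHalfPlane Filter Topology PowerSeries Derivative ModularForm
open scoped Manifold Real Nat

/-- The function `₂F₁(a, b; n + 1; 1728 z)`. -/
def hyp (a b : ℂ) (n : ℕ) (z : ℂ) : ℂ := ₂F₁ a b ((n : ℂ) + 1) (1728 * z)

section hyp

variable {a b : ℂ}

lemma natCast_add_one_add_natCast_ne (n k : ℕ) : (n : ℂ) + 1 + k ≠ 0 := by
  exact_mod_cast (by omega : n + 1 + k ≠ 0)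

lemma hyp_zero (n : ℕ) : hyp a b n 0 = 1 := by simp [hyp]

lemma hasFPowerSeriesAt_ordinaryHypergeometric (ha : ∀ k : ℕ, (k : ℂ) ≠ -a)
    (hb : ∀ k : ℕ, (k : ℂ) ≠ -b) (n : ℕ) :
    HasFPowerSeriesAt (₂F₁ a b ((n : ℂ) + 1) : ℂ → ℂ)
      (ordinaryHypergeometricSeries ℂ a b ((n : ℂ) + 1)) 0 := by
  have hr := ordinaryHypergeometricSeries_radius_eq_one ℂ a b ((n : ℂ) + 1) fun k =>
    ⟨ha k, hb k, fun h => natCast_add_one_add_natCast_ne n k (by rw [h]; ring)⟩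
  exact (FormalMultilinearSeries.hasFPowerSeriesOnBall _ (by rw [hr]; exact one_pos))
    |>.hasFPowerSeriesAt

lemma analyticAt_hyp (ha : ∀ k : ℕ, (k : ℂ) ≠ -a)
    (hb : ∀ k : ℕ, (k : ℂ) ≠ -b) (n : ℕ) : AnalyticAt ℂ (hyp a b n) 0 := by
  have h := (hasFPowerSeriesAt_ordinaryHypergeometric ha hb n).analyticAt
  have h2 : AnalyticAt ℂ (fun z : ℂ => 1728 * z) 0 := analyticAt_const.mul analyticAt_id
  refine AnalyticAt.comp (f := fun z : ℂ => 1728 * z) ?_ h2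
  simpa using h

lemma iteratedDeriv_comp_mul_left (m : ℕ) (f : ℂ → ℂ) (c : ℂ) :
    iteratedDeriv m (fun z => f (c * z)) = fun z => c ^ m * iteratedDeriv m f (c * z) := by
  induction m generalizing f with
  | zero => simp
  | succ m ih =>
    have h : deriv (fun z => f (c * z)) = fun z => c * deriv f (c * z) := by
      ext z
      rw [deriv_comp_mul_left, smul_eq_mul]
    ext z
    rw [iteratedDeriv_succ', h, iteratedDeriv_const_mul_field, ih, iteratedDeriv_succ']
    ring

lemma coeff_taylor_hyp (ha : ∀ k : ℕ, (k : ℂ) ≠ -a)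
    (hb : ∀ k : ℕ, (k : ℂ) ≠ -b) (n : ℕ) (m : ℕ) : coeff m (taylor (hyp a b n)) =
    1728 ^ m * ordinaryHypergeometricCoefficient a b ((n : ℂ) + 1) m := by
  have h := hasFPowerSeriesAt_ordinaryHypergeometric ha hb n
  have h1 := congrArg (FormalMultilinearSeries.coeff · m)
    (h.analyticAt.hasFPowerSeriesAt.eq_formalMultilinearSeries h)
  simp only [ordinaryHypergeometricSeries, FormalMultilinearSeries.coeff_ofScalars] at h1
  rw [coeff_taylor, ← h1]
  have h2 := congrFun (iteratedDeriv_comp_mul_left m (₂F₁ a b ((n : ℂ) + 1) : ℂ → ℂ) 1728) 0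
  rw [mul_zero] at h2
  rw [show hyp a b n = fun z => ₂F₁ a b ((n : ℂ) + 1) (1728 * z) from rfl, h2]
  ring

lemma ordinaryHypergeometricCoefficient_succ (a b : ℂ) (n m : ℕ) :
    ((m : ℂ) + 1) * ((n : ℂ) + 1 + m) *
      ordinaryHypergeometricCoefficient a b ((n : ℂ) + 1) (m + 1) =
    (a + m) * (b + m) * ordinaryHypergeometricCoefficient a b ((n : ℂ) + 1) m := by
  have h1 := natCast_add_one_add_natCast_ne n m
  have h2 : (m : ℂ) + 1 ≠ 0 := by exact_mod_cast m.succ_ne_zero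
  have h3 : (m ! : ℂ) ≠ 0 := by exact_mod_cast m.factorial_ne_zero
  simp only [ordinaryHypergeometricCoefficient, ascPochhammer_succ_eval, Nat.factorial_succ]
  push_cast
  simp only [mul_inv]
  field_simp

/-- The hypergeometric differential equation. -/
lemma eventually_hyp_equation (ha : ∀ k : ℕ, (k : ℂ) ≠ -a)
    (hb : ∀ k : ℕ, (k : ℂ) ≠ -b) (n : ℕ) :
    ∀ᶠ z in 𝓝 0,
    let f := hyp a b n
    let f₁ := fun z => z * deriv f z
    z * deriv f₁ z + n * f₁ z =
      1728 * (z * (z * deriv f₁ z + ((a + b) * f₁ z + a * b * f z))) := by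
  set f := hyp a b n with hfdef
  set f₁ : ℂ → ℂ := fun z => z * deriv f z with hf₁def
  have hf : AnalyticAt ℂ f 0 := analyticAt_hyp ha hb n
  have hf₁ : AnalyticAt ℂ f₁ 0 := analyticAt_id.mul hf.deriv
  have hf₂ : AnalyticAt ℂ (fun z => z * deriv f₁ z) 0 := analyticAt_id.mul hf₁.deriv
  have h₁ : taylor f₁ = theta (taylor f) := taylor_theta hf
  have h₂ : taylor (fun z => z * deriv f₁ z) = theta (theta (taylor f)) := by
    rw [taylor_theta hf₁, h₁]
  have hr : AnalyticAt ℂ (fun z => (a + b) * f₁ z + a * b * f z) 0 :=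
    (analyticAt_const.mul hf₁).add (analyticAt_const.mul hf)
  refine eventually_eq_of_taylor_eq (f := fun z => z * deriv f₁ z + n * f₁ z)
    (g := fun z => 1728 * (z * (z * deriv f₁ z + ((a + b) * f₁ z + a * b * f z))))
    (hf₂.add (analyticAt_const.mul hf₁))
    (analyticAt_const.mul (analyticAt_id.mul (hf₂.add hr))) ?_
  rw [taylor_add (g := fun z => n * f₁ z) hf₂ (analyticAt_const.mul hf₁), taylor_const_mul,
    taylor_const_mul, taylor_mul (f := fun z => z)
      (g := fun z => z * deriv f₁ z + ((a + b) * f₁ z + a * b * f z)) analyticAt_id (hf₂.add hr),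
    taylor_add hf₂ hr, taylor_linear hf₁ hf, taylor_id, h₁, h₂]
  ext m
  rw [map_add, coeff_C_mul, coeff_C_mul]
  rcases m with _ | m
  · simp
  · rw [coeff_succ_X_mul]
    rw [(coeff m).map_add, (coeff m).map_add, coeff_C_mul, coeff_C_mul]
    simp only [coeff_theta]
    rw [coeff_taylor_hyp ha hb, coeff_taylor_hyp ha hb]
    -- In terms of θ = z d/dz the equation is θ(θ + n)f = 1728z(θ + a)(θ + b)f; its coefficients are
    -- the ratio recursion rescaled by 1728^(m+1).
    have := ordinaryHypergeometricCoefficient_succ a b n m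
    push_cast
    linear_combination 1728 ^ (m + 1) * this

/-- If `a + a' = n`, then `u = ₂F₁(a, a' + 1/2; n + 1; 1728 / j)` extends to a solution `(u, v)`
of the first order system. -/
lemma exists_system {a a' : ℂ} (h0 : a ≠ 0) (ha : ∀ k : ℕ, (k : ℂ) ≠ -a)
    (hb : ∀ k : ℕ, (k : ℂ) ≠ -(a' + 1 / 2)) (n : ℕ) (haa : a + a' = n) :
    let u := fun q => hyp a (a' + 1 / 2) n (qJInv q)
    AnalyticAt ℂ u 0 ∧ u 0 = 1 ∧ ∃ v : ℂ → ℂ, AnalyticAt ℂ v 0 ∧ v 0 = 1 ∧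
      ∀ᶠ q in 𝓝 0, HasTheta u (a * (qE4Root q ^ 2 * v q - qE6 q / qE4 q * u q)) q ∧
        HasTheta v (a' * (qE4Root q ^ 2 * u q - qE6 q / qE4 q * v q)) q := by
  intro u
  set f := hyp a (a' + 1 / 2) n with hfdef
  set f₁ : ℂ → ℂ := fun z => z * deriv f z with hf₁def
  have hf : AnalyticAt ℂ f 0 := analyticAt_hyp ha hb n
  have hf₁ : AnalyticAt ℂ f₁ 0 := analyticAt_id.mul hf.deriv
  have hu : AnalyticAt ℂ u 0 :=
    AnalyticAt.comp (g := f) (f := qJInv) (by rw [qJInv_zero]; exact hf) analyticAt_qJInv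
  have hu₁ : AnalyticAt ℂ (fun q => f₁ (qJInv q)) 0 :=
    AnalyticAt.comp (g := f₁) (f := qJInv) (by rw [qJInv_zero]; exact hf₁) analyticAt_qJInv
  -- The first equation of the system, solved for v, dictates this witness; this is where a ≠ 0 is
  -- needed.
  refine ⟨hu, by simp only [u, qJInv_zero, hyp_zero],
    fun q => qE6 q / qE4 q / qE4Root q ^ 2 * (u q + a⁻¹ * f₁ (qJInv q)), ?_, ?_, ?_⟩
  · exact ((analyticAt_qE6.div analyticAt_qE4 (by simp [qE4_zero])).div
      (analyticAt_qE4Root.pow 2) (by simp [qE4Root_zero])).mul (hu.add (analyticAt_const.mul hu₁))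
  · simp [u, qJInv_zero, hfdef, hyp_zero, f₁, qE4Root_zero, qE4_zero, qE6_zero]
  have ht : Tendsto qJInv (𝓝 0) (𝓝 0) := by
    have := analyticAt_qJInv.continuousAt.tendsto
    rwa [qJInv_zero] at this
  filter_upwards [eventually_thetaEquations, ht.eventually hf.eventually_analyticAt,
    ht.eventually hf₁.eventually_analyticAt, ht.eventually (eventually_hyp_equation ha hb n)]
    with q hq h1 h2 h3
  have hg := hq.root_ne
  have h4 := hq.E4_ne
  have hu' : HasTheta u (qE6 q / qE4 q * f₁ (qJInv q)) q :=
    (HasTheta.comp h1.differentiableAt.hasDerivAt hq.hJInv).congr_val (by simp only [f₁]; ring)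
  have hu₁' : HasTheta (fun q => f₁ (qJInv q))
      (qE6 q / qE4 q * (qJInv q * deriv f₁ (qJInv q))) q :=
    (HasTheta.comp h2.differentiableAt.hasDerivAt hq.hJInv).congr_val (by ring)
  constructor
  · refine hu'.congr_val ?_
    field_simp
    ring
  · have h6 : qE6 q ^ 2 = qE4 q ^ 3 * (1 - 1728 * qJInv q) := by
      rw [qJInv]; field_simp; ring
    -- The function σ = E₆/E₄^(3/2) satisfies σ² = 1 − 1728/j; differentiating halves 1728 to 864.
    have hσ : HasTheta (fun q => qE6 q / qE4 q / qE4Root q ^ 2)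
        (-(864 * qE4Root q ^ 2 * qJInv q)) q := by
      refine ((hq.hE6.div hq.hE4 h4).div (hq.hRoot.pow_eq rfl 2) (pow_ne_zero 2 hg)).congr_val ?_
      rw [← hq.root_pow] at h6 ⊢
      field_simp
      linear_combination 36 * h6
    refine (hσ.mul (hu'.add (hu₁'.const_mul a⁻¹))).congr_val ?_
    change qJInv q * deriv f₁ (qJInv q) + n * f₁ (qJInv q) = 1728 * (qJInv q *
      (qJInv q * deriv f₁ (qJInv q) + ((a + (a' + 1 / 2)) * f₁ (qJInv q) +
        a * (a' + 1 / 2) * u q))) at h3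
    have hr : qE6 q / qE4 q = qE6 q / qE4 q / qE4Root q ^ 2 * qE4Root q ^ 2 := by field_simp
    have hs : (qE6 q / qE4 q / qE4Root q ^ 2) ^ 2 = 1 - 1728 * qJInv q := by
      rw [← hq.root_pow] at h6 ⊢
      field_simp
      linear_combination h6
    rw [hr, mul_div_cancel_right₀ _ (pow_ne_zero 2 hg)]
    -- What remains is polynomial: the hypergeometric equation with n = a + a′, modulo σ² = 1 −
    -- 1728/j.
    generalize qE6 q / qE4 q / qE4Root q ^ 2 = σ at *
    generalize qJInv q * deriv f₁ (qJInv q) = w₂ at *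
    generalize f₁ (qJInv q) = w₁ at *
    rw [← haa] at h3
    field_simp
    linear_combination h3 + (a * w₁ + w₂ + a' * (a * u q + w₁)) * hs

end hyp

end

/-! ### Hypergeometric formulas for the bases -/

section
open UpperHalfPlane Filter Topology PowerSeries Derivative ModularForm
open scoped Manifold Real Nat

/-- By parity, 12k + 6n + c is never 0. Hence no upper parameter is a nonpositive integer and the
radius of convergence is exactly 1. -/
lemma natCast_ne_neg_of_odd {c : ℤ} (hc : Odd c) (n : ℕ) {x : ℂ} (hx : x = (6 * n + c) / 12)
    (k : ℕ) : (k : ℂ) ≠ -x := by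
  intro h
  have h1 : (12 * k + 6 * n + c : ℂ) = 0 := by rw [h, hx]; ring
  have h2 : (12 * k + 6 * n + c : ℤ) = 0 := by exact_mod_cast h1
  obtain ⟨d, rfl⟩ := hc
  omega

lemma ne_zero_of_odd {c : ℤ} (hc : Odd c) (n : ℕ) {x : ℂ} (hx : x = (6 * n + c) / 12) : x ≠ 0 :=
  fun h => natCast_ne_neg_of_odd hc n hx 0 (by simp [h])

lemma extremal0_eq_hyp (n : ℕ) : cuspFunction 1 (extremal0 n) =ᶠ[𝓝 0] fun q =>
    qE4Root q ^ (6 * n) / qE4Root q *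
      (qJInv q ^ n * hyp ((6 * n + 1) / 12) ((6 * n + 5) / 12) n (qJInv q)) := by
  have hb : ((6 * n - 1) / 12 + 1 / 2 : ℂ) = (6 * n + 5) / 12 := by ring
  obtain ⟨hu, hu0, v, hv, hv0, h⟩ := exists_system (a := (6 * n + 1) / 12) (a' := (6 * n - 1) / 12)
    (ne_zero_of_odd (c := 1) (by decide) n (by push_cast; ring))
    (natCast_ne_neg_of_odd (c := 1) (by decide) n (by push_cast; ring))
    (natCast_ne_neg_of_odd (c := 5) (by decide) n (by push_cast; ring)) n (by ring)
  rw [hb] at hu hu0 h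
  exact (extremal_eventuallyEq_of_system n hu hv hu0 hv0 h).1

lemma extremal2_eq_hyp (n : ℕ) : cuspFunction 1 (extremal2 n) =ᶠ[𝓝 0] fun q =>
    qE4Root q ^ (6 * n) * qE4Root q *
      (qJInv q ^ n * hyp ((6 * n - 1) / 12) ((6 * n + 7) / 12) n (qJInv q)) := by
  have hb : ((6 * n + 1) / 12 + 1 / 2 : ℂ) = (6 * n + 7) / 12 := by ring
  obtain ⟨hu, hu0, v, hv, hv0, h⟩ := exists_system (a := (6 * n - 1) / 12) (a' := (6 * n + 1) / 12)
    (ne_zero_of_odd (c := -1) (by decide) n (by push_cast; ring))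
    (natCast_ne_neg_of_odd (c := -1) (by decide) n (by push_cast; ring))
    (natCast_ne_neg_of_odd (c := 7) (by decide) n (by push_cast; ring)) n (by ring)
  rw [hb] at hu hu0 h
  -- The system is symmetric under exchanging (u, a) with (v, a′), so the hypergeometric solution
  -- now takes the role of the second unknown.
  exact (extremal_eventuallyEq_of_system n hv hu hv0 hu0 (h.mono fun q hq => hq.symm)).2

lemma F1_eq_hyp (t : ℂ) : F1 t = hyp ((6 * (0 : ℕ) + 1) / 12) ((6 * (0 : ℕ) + 5) / 12) 0 t := by
  simp [F1, hyp]

lemma P_eq (n : ℕ) (t : ℂ) : P n t = F1 t * hyp ((6 * n + 1) / 12) ((6 * n + 5) / 12) n t := rfl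

lemma Q_eq (n : ℕ) (t : ℂ) : Q n t = F1 t * hyp ((6 * n - 1) / 12) ((6 * n + 7) / 12) n t := rfl

/-- This is the case n = 0, in which the extremal form is the constant 1. -/
lemma eventually_F1_eq : ∀ᶠ q in 𝓝 0, F1 (qJInv q) = qE4Root q := by
  have h1 : cuspFunction 1 (1 : ℍ → ℂ) =ᶠ[𝓝 0] fun _ => 1 :=
    cuspFunction_eventuallyEq (regular_of_mem_QM leading_one.1) continuousAt_const fun _ => rfl
  have h2 : extremal0 0 = 1 := if_pos rfl
  have h3 := extremal0_eq_hyp 0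
  rw [h2] at h3
  filter_upwards [h1, h3, eventually_thetaEquations] with q h1 h3 h4
  rw [h1] at h3
  have := h4.root_ne
  rw [F1_eq_hyp]
  field_simp at h3
  rw [Nat.mul_zero, pow_zero, one_mul] at h3
  exact h3.symm

/-- The values near `i∞` of `E₄` and of the extremal forms in terms of hypergeometric functions. -/
structure HypergeometricEquations (n : ℕ) (τ : ℍ) : Prop where
  F1_ne : F1 (jInv τ) ≠ 0
  hE4 : E4 τ = F1 (jInv τ) ^ 4
  hP : F1 (jInv τ) ^ 2 * extremal0 n τ = F1 (jInv τ) ^ (6 * n) * (jInv τ ^ n * P n (jInv τ))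
  hQ : extremal2 n τ = F1 (jInv τ) ^ (6 * n) * (jInv τ ^ n * Q n (jInv τ))

lemma eventually_hypergeometricEquations (n : ℕ) :
    ∀ᶠ τ in atImInfty, HypergeometricEquations n τ := by
  filter_upwards [(qParam_tendsto_atImInfty one_pos).eventually (eventually_F1_eq.and
    (eventually_thetaEquations.and ((extremal0_eq_hyp n).and (extremal2_eq_hyp n))))] with τ h
  obtain ⟨h1, h2, h3, h4⟩ := h
  rw [← (regular_of_mem_QM (leading_extremal0 n).1).eq_cuspFunction] at h3
  rw [← (regular_of_mem_QM (leading_extremal2 n).1).eq_cuspFunction] at h4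
  have hE4 : E4 τ = qE4 (Function.Periodic.qParam 1 τ) := regular_E4.eq_cuspFunction τ
  have hj : jInv τ = qJInv (Function.Periodic.qParam 1 τ) := by
    have h0 := h2.E4_ne
    have hE6 : E₆ τ = qE6 (Function.Periodic.qParam 1 τ) := regular_E6.eq_cuspFunction τ
    have hd := discriminant_eq_E₄_cube_sub_E₆_sq τ
    change _ = (E4 τ ^ 3 - _) / _ at hd
    rw [jInv, qJInv, hd, hE4, hE6]
    field_simp
  have hne := h2.root_ne
  rw [← hj] at h1 h3 h4
  rw [← h1] at h3 h4 hne
  refine ⟨hne, by rw [hE4, ← h2.root_pow, ← h1], ?_, ?_⟩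
  · rw [h3, P_eq]; field_simp
  · rw [h4, Q_eq]; ring

lemma germs_eq_germs {S T : Set (ℍ → ℂ)} (h1 : ∀ f ∈ S, ∃ g ∈ T, f =ᶠ[atImInfty] g)
    (h2 : ∀ g ∈ T, ∃ f ∈ S, f =ᶠ[atImInfty] g) : germs S = germs T := by
  ext x
  constructor
  · rintro ⟨f, hf, rfl⟩
    obtain ⟨g, hg, hfg⟩ := h1 f hf
    exact ⟨g, hg, Germ.coe_eq.mpr hfg.symm⟩
  · rintro ⟨g, hg, rfl⟩
    obtain ⟨f, hf, hfg⟩ := h2 g hg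
    exact ⟨f, hf, Germ.coe_eq.mpr hfg⟩

lemma zpow_twelve_mul_sub_two {x : ℂ} (hx : x ≠ 0) (m : ℕ) :
    x ^ (12 * (m : ℤ) - 2) = x ^ (12 * m) / x ^ 2 := by
  rw [zpow_sub₀ hx]; norm_cast

lemma E4_pow_mul_extremal0_even {m l : ℕ} (hl : l ≤ m) :
    E4 ^ (3 * (m - l)) * extremal0 (2 * l) =ᶠ[atImInfty] fun τ =>
      F1 (jInv τ) ^ (12 * (m : ℤ) - 2) * (jInv τ ^ (2 * l) * P (2 * l) (jInv τ)) := by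
  filter_upwards [eventually_hypergeometricEquations (2 * l)] with τ h
  have h0 := h.F1_ne
  obtain ⟨c, rfl⟩ := Nat.exists_eq_add_of_le hl
  rw [zpow_twelve_mul_sub_two h0, Pi.mul_apply, Pi.pow_apply, h.hE4, Nat.add_sub_cancel_left]
  field_simp
  linear_combination F1 (jInv τ) ^ (12 * c) * h.hP

lemma E4_pow_mul_extremal2_odd {m l : ℕ} (hl : l < m) :
    E4 ^ (3 * (m - l) - 2) * extremal2 (2 * l + 1) =ᶠ[atImInfty] fun τ =>
      F1 (jInv τ) ^ (12 * (m : ℤ) - 2) * (jInv τ ^ (2 * l + 1) * Q (2 * l + 1) (jInv τ)) := by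
  filter_upwards [eventually_hypergeometricEquations (2 * l + 1)] with τ h
  have h0 := h.F1_ne
  obtain ⟨c, rfl⟩ := Nat.exists_eq_add_of_lt hl
  rw [zpow_twelve_mul_sub_two h0, Pi.mul_apply, Pi.pow_apply, h.hE4, h.hQ,
    show 3 * (l + c + 1 - l) - 2 = 3 * c + 1 by omega]
  field_simp
  ring

lemma E4_pow_mul_extremal2_even {m l : ℕ} (hl : l ≤ m) :
    E4 ^ (3 * (m - l)) * extremal2 (2 * l) =ᶠ[atImInfty] fun τ =>
      F1 (jInv τ) ^ (12 * m) * (jInv τ ^ (2 * l) * Q (2 * l) (jInv τ)) := by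
  filter_upwards [eventually_hypergeometricEquations (2 * l)] with τ h
  obtain ⟨c, rfl⟩ := Nat.exists_eq_add_of_le hl
  rw [Pi.mul_apply, Pi.pow_apply, h.hE4, h.hQ, Nat.add_sub_cancel_left]
  ring

lemma E4_pow_mul_extremal0_odd {m l : ℕ} (hl : l < m) :
    E4 ^ (3 * (m - l) - 2) * (E4 * extremal0 (2 * l + 1)) =ᶠ[atImInfty] fun τ =>
      F1 (jInv τ) ^ (12 * m) * (jInv τ ^ (2 * l + 1) * P (2 * l + 1) (jInv τ)) := by
  filter_upwards [eventually_hypergeometricEquations (2 * l + 1)] with τ h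
  have h0 := h.F1_ne
  obtain ⟨c, rfl⟩ := Nat.exists_eq_add_of_lt hl
  rw [Pi.mul_apply, Pi.mul_apply, Pi.pow_apply, h.hE4,
    show 3 * (l + c + 1 - l) - 2 = 3 * c + 1 by omega]
  apply mul_left_cancel₀ (pow_ne_zero 2 h0)
  linear_combination F1 (jInv τ) ^ (12 * c + 8) * h.hP

lemma extremal0_two_mul {l : ℕ} (hl : 1 ≤ l) : extremal0 (2 * l) = G (12 * l) := by
  rw [extremal0, if_neg (by omega), show 6 * (2 * l) = 12 * l by ring]

/-- Weights 12l + 6 and 12l + 10 have the same dimension, so E₄ carries one extremal form to the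
other. -/
lemma E4_mul_extremal0 (l : ℕ) : E4 * extremal0 (2 * l + 1) = G (12 * l + 10) := by
  have h := (leading_extremal0 (2 * l + 1)).E4_mul
  rw [show 6 * (2 * l + 1) + 4 = 12 * l + 10 by ring] at h
  refine eq_G (by simp [parity_simps]) (by omega) (by omega) h.1 ?_
  rw [show (12 * l + 10) / 6 = 2 * l + 1 by omega]
  exact h.2

theorem germs_basis0 (m : ℕ) : germs (basis0 m) = germs (hypBasis0 m) := by
  have hG2 (l : ℕ) : G (12 * l + 8) = extremal2 (2 * l + 1) := by
    rw [extremal2, show 6 * (2 * l + 1) + 2 = 12 * l + 8 by ring]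
  have h1 : extremal0 (2 * 0) = 1 := if_pos rfl
  have hE : E4 ^ (3 * m) = E4 ^ (3 * (m - 0)) * extremal0 (2 * 0) := by rw [h1, mul_one]; rfl
  apply germs_eq_germs
  · rintro f ((rfl | ⟨l, hl, hlm, rfl⟩) | ⟨l, hlm, rfl⟩)
    · rw [hE]
      exact ⟨_, ⟨_, Or.inl ⟨0, Nat.zero_le m, rfl⟩, rfl⟩, E4_pow_mul_extremal0_even (Nat.zero_le m)⟩
    · rw [← extremal0_two_mul hl]
      exact ⟨_, ⟨_, Or.inl ⟨l, hlm, rfl⟩, rfl⟩, E4_pow_mul_extremal0_even hlm⟩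
    · rw [hG2]
      exact ⟨_, ⟨_, Or.inr ⟨l, hlm, rfl⟩, rfl⟩, E4_pow_mul_extremal2_odd hlm⟩
  · rintro g ⟨_, (⟨l, hlm, rfl⟩ | ⟨l, hlm, rfl⟩), rfl⟩
    · rcases Nat.eq_zero_or_pos l with rfl | hl
      · exact ⟨_, Or.inl (Or.inl hE.symm), E4_pow_mul_extremal0_even hlm⟩
      · exact ⟨_, Or.inl (Or.inr ⟨l, hl, hlm, by rw [extremal0_two_mul hl]⟩),
          E4_pow_mul_extremal0_even hlm⟩
    · exact ⟨_, Or.inr ⟨l, hlm, by rw [hG2]⟩, E4_pow_mul_extremal2_odd hlm⟩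

theorem germs_basis2 (m : ℕ) : germs (basis2 m) = germs (hypBasis2 m) := by
  have hG2 (l : ℕ) : G (12 * l + 2) = extremal2 (2 * l) := by
    rw [extremal2, show 6 * (2 * l) + 2 = 12 * l + 2 by ring]
  apply germs_eq_germs
  · rintro f (⟨l, hlm, rfl⟩ | ⟨l, hlm, rfl⟩)
    · rw [hG2]
      exact ⟨_, ⟨_, Or.inl ⟨l, hlm, rfl⟩, rfl⟩, E4_pow_mul_extremal2_even hlm⟩
    · rw [← E4_mul_extremal0]
      exact ⟨_, ⟨_, Or.inr ⟨l, hlm, rfl⟩, rfl⟩, E4_pow_mul_extremal0_odd hlm⟩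
  · rintro g ⟨_, (⟨l, hlm, rfl⟩ | ⟨l, hlm, rfl⟩), rfl⟩
    · exact ⟨_, Or.inl ⟨l, hlm, by rw [hG2]⟩, E4_pow_mul_extremal2_even hlm⟩
    · exact ⟨_, Or.inr ⟨l, hlm, by rw [E4_mul_extremal0]⟩, E4_pow_mul_extremal0_odd hlm⟩

end

end Quasimodular

end

theorem mainTheorem10 :
    (∀ w : ℕ, Even w → 2 ≤ w → w ≠ 4 →
      ∃! f : UpperHalfPlane → ℂ, Quasimodular.IsNormalizedExtremal (w : ℤ) 1 f) ∧
    (∀ k : ℕ, Even k → 2 ≤ k →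
      ∃ b : Module.Basis (Fin (Module.finrank ℂ (Quasimodular.QM (k : ℤ) 1))) ℂ
          (Quasimodular.QM (k : ℤ) 1),
        Set.range (fun i => (b i : UpperHalfPlane → ℂ)) = Quasimodular.extremalBasis k ∧
        ∀ i, Quasimodular.HasLeadingTerm (b i : UpperHalfPlane → ℂ) (i : ℕ)) ∧
    (∀ m : ℕ,
      Quasimodular.germs (Quasimodular.basis0 m) =
        Quasimodular.germs (Quasimodular.hypBasis0 m) ∧
      Quasimodular.germs (Quasimodular.basis2 m) =
        Quasimodular.germs (Quasimodular.hypBasis2 m)) := by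
  refine ⟨fun w hw h2 h4 => Quasimodular.existsUnique_isNormalizedExtremal hw h2 h4,
    fun k hk h2 => Quasimodular.exists_basis_range_eq_extremalBasis hk h2,
    fun m => ⟨Quasimodular.germs_basis0 m, Quasimodular.germs_basis2 m⟩⟩
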